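/- Permutations are finite and may be empty ($\epsilon$ is the empty permutation). A set of permutations is a *permutation class* if it is closed downwards under pattern containment, and $\operatorname{Av}(\beta)$ is the class of permutations not containing $\beta$. For sets $\mathcal C,\mathcal D$ of permutations, $\mathcal C\mid\mathcal D$ is the set of permutations $\pi=\pi(1)\cdots\pi(n)$ for which there is an index $0\le i\le n$ such that $\pi(1)\cdots\pi(i)$ is order-isomorphic to a member of $\mathcal C\cup\{\epsilon\}$ and $\pi(i+1)\cdots\pi(n)$ is order-isomorphic to a member of $\mathcal D\cup\{\epsilon\}$. A *specification* $\mathscr S$ is a finite system of equations $\mathcal S_i=f_i(\mathcal E,\mathcal Z,\mathcal Z^{L},\mathcal Z^{R},\mathcal Z^{LR},\mathcal S_1,\dots,\mathcal S_r)$, $1\le i\le r$, where each $f_i$ is an expression built with disjoint sum $+$, (noncommutative) Cartesian product $\times$ and $\mathrm{Seq}(\cdot)$ from the neutral class $\mathcal E$ (one object, of size $0$), four atoms of size $1$, and the class symbols. It specifies the class $\mathcal S_1$ of its least solution; it is required that each $\mathcal S_i$ has finitely many objects of each size and that $\mathrm{Seq}$ is applied only to classes without objects of size $0$. The specification is *context-free*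 if no $f_i$ uses $\mathrm{Seq}$, and *regular* if no $f_i$ contains a class symbol (only $\mathcal E$, atoms and $+,\times,\mathrm{Seq}$). Given a set $\mathcal C$ of permutations, $\mathscr S$ is a bottom-to-top specification for $\mathcal C$ that *tracks the rightmost entry* if there is a bijection from the objects of $\mathcal S_1$ to $\mathcal C$ such that the atoms of each object, in left-to-right reading order, are the entries of the corresponding permutation read from bottom to top, where the rightmost entry is represented by $\mathcal Z^{R}$ and every other entry by $\mathcal Z$. It *tracks the leftmost entry* if the same holds with the leftmost entry represented by $\mathcal Z^{L}$ and every other entry by $\mathcal Z$. It *tracks both* if the same holds with the leftmost entry represented by $\mathcal Z^{L}$, the rightmost by $\mathcal Z^{R}$ (by $\mathcal Z^{LR}$ if the two coincide), and every other entry by $\mathcal Z$. **Theorem.** Let $\mathcal C$ be a set of permutations such that $\mathcal C\cup\{\epsilon\}$ is a permutation class (so $\mathcal C$ is a permutation class, possibly with the empty permutation left out), let $\mathcal M\in\{\operatorname{Av}(21),\operatorname{Av}(12)\}$, and let $\mathscr S$ be a specification. 1. If $\mathscr S$ is a specification for $\mathcal C$ that tracks the rightmost entry, then there is a specification for $\mathcal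 C\mid\mathcal M$ that tracks the rightmost entry. 2. If $\mathscr S$ is a specification for $\mathcal C$ that tracks the leftmost entry, then there is a specification for $\mathcal M\mid\mathcal C$ that tracks the leftmost entry. 3. If $\mathscr S$ is a specification for $\mathcal C$ that tracks both the leftmost and the rightmost entries, then there are specifications for $\mathcal C\mid\mathcal M$ and for $\mathcal M\mid\mathcal C$ that track both. 4. In each of 1, 2 and 3, if $\mathscr S$ is context-free, then the new specifications can be chosen context-free; if $\mathscr S$ is regular, then they can be chosen regular. -/

import Mathlib

/-! ### Permutations, containment, classes, juxtapositions -/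

/-- A finite permutation `π(1) ⋯ π(n)` of any length `n ≥ 0`: position `i` carries the value
`π.2 i` (positions and values are numbered from `0`). -/
abbrev Permutation : Type := Σ n : ℕ, Equiv.Perm (Fin n)

namespace Permutation

/-- The empty permutation. -/
def nil : Permutation := ⟨0, 1⟩

/-- The permutation `12`. -/
def p12 : Permutation := ⟨2, 1⟩

/-- The permutation `21`. -/
def p21 : Permutation := ⟨2, Equiv.swap 0 1⟩

/-- The entries of `π` at the positions `f 0, f 1, …` are in the same relative order as the entries
of `σ`. -/
def OrderIsoAt (σ π : Permutation) (f : Fin σ.1 → Fin π.1) : Prop :=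
  ∀ i j : Fin σ.1, σ.2 i < σ.2 j ↔ π.2 (f i) < π.2 (f j)

/-- `σ` is contained in `π`: some subsequence of `π` is order-isomorphic to `σ`. -/
def Contained (σ π : Permutation) : Prop :=
  ∃ f : Fin σ.1 ↪o Fin π.1, OrderIsoAt σ π f

/-- A permutation class: a set of permutations closed downwards under containment. -/
def IsPermClass (C : Set Permutation) : Prop :=
  ∀ π ∈ C, ∀ σ, Contained σ π → σ ∈ C

/-- `Av B`: the permutations that contain no member of `B`. -/
def Av (B : Set Permutation) : Set Permutation :=
  {π | ∀ β ∈ B, ¬ Contained β π}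

/-- `π` is a juxtaposition of `σ` with `τ`: the length of `π` is `|σ| + |τ|`, the first `|σ|`
entries of `π` are order-isomorphic to `σ`, the other `|τ|` entries are order-isomorphic to `τ`. -/
def IsJuxtaposition (π σ τ : Permutation) : Prop :=
  ∃ h : σ.1 + τ.1 = π.1,
    OrderIsoAt σ π (fun i => Fin.cast h (Fin.castAdd τ.1 i)) ∧
    OrderIsoAt τ π (fun j => Fin.cast h (Fin.natAdd σ.1 j))

/-- The juxtaposition `C ∣ D` of two sets of permutations. -/
def juxtapose (C D : Set Permutation) : Set Permutation :=
  {π | ∃ σ ∈ insert nil C, ∃ τ ∈ insert nil D, IsJuxtaposition π σ τ}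

end Permutation

/-! ### Atoms and the bottom-to-top reading of a permutation -/

/-- The four atoms `𝒵`, `𝒵ᴸ`, `𝒵ᴿ`, `𝒵ᴸᴿ`, each of size one. -/
inductive Atom : Type
  | Z
  | ZL
  | ZR
  | ZLR

/-- The atom for an entry, according to whether it is marked as leftmost, as rightmost, or both. -/
def Atom.ofMarks (isLeft isRight : Bool) : Atom :=
  match isLeft, isRight with
  | false, false => Atom.Z
  | true, false => Atom.ZL
  | false, true => Atom.ZR
  | true, true => Atom.ZLR

/-- The entries of `π` read from bottom to top (by increasing value), each replaced by its atom. The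
leftmost entry is marked when `trackL` is true, the rightmost entry when `trackR` is true. -/
def Permutation.bottomToTop (trackL trackR : Bool) (π : Permutation) : List Atom :=
  List.ofFn fun v : Fin π.1 =>
    Atom.ofMarks
      (trackL && decide ((π.2.symm v : ℕ) = 0))
      (trackR && decide ((π.2.symm v : ℕ) + 1 = π.1))

/-! ### Combinatorial specifications -/

/-- The right-hand sides of a specification with class symbols in `ι`: expressions built from the
neutral class `ℰ`, the atoms and the class symbols by `+`, `×` and `Seq`. -/
inductive Constructor (ι : Type) : Type
  | neutral : Constructor ι
  | atom : Atom → Constructor ι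
  | cls : ι → Constructor ι
  | sum : Constructor ι → Constructor ι → Constructor ι
  | prod : Constructor ι → Constructor ι → Constructor ι
  | seq : Constructor ι → Constructor ι

namespace Constructor

/-- The expression does not use `Seq`. -/
def SeqFree {ι : Type} : Constructor ι → Prop
  | neutral => True
  | atom _ => True
  | cls _ => True
  | sum a b => SeqFree a ∧ SeqFree b
  | prod a b => SeqFree a ∧ SeqFree b
  | seq _ => False

/-- The expression does not use any class symbol: it is built from `ℰ` and atoms only. -/
def ClassFree {ι : Type} : Constructor ι → Prop
  | neutral => True
  | atom _ => True
  | cls _ => False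
  | sum a b => ClassFree a ∧ ClassFree b
  | prod a b => ClassFree a ∧ ClassFree b
  | seq a => ClassFree a

end Constructor

/-- A finite system of equations `𝒮ᵢ = fᵢ(ℰ, atoms, 𝒮₁, …, 𝒮ᵣ)`, one for each class symbol, with a
distinguished symbol `start` (the `𝒮₁` of the system). -/
structure Specification : Type 1 where
  /-- the class symbols -/
  Idx : Type
  /-- there are finitely many equations -/
  finite_idx : Finite Idx
  /-- the symbol of the class that is being specified -/
  start : Idx
  /-- the right-hand sides of the equations -/
  eqn : Idx → Constructor Idx

namespace Specification

/-- The combinatorial objects denoted by an expression, when the class symbols are interpreted by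
the least solution of the system: an object of `𝒮ᵢ` is an object of the right-hand side of its
equation, an object of `A + B` is an object of `A` or an object of `B` (disjoint union), an object
of `A × B` is an ordered pair, an object of `Seq(A)` is a finite sequence of objects of `A`. -/
inductive Obj (S : Specification) : Constructor S.Idx → Type
  | neutral : Obj S Constructor.neutral
  | atom (a : Atom) : Obj S (Constructor.atom a)
  | cls (i : S.Idx) : Obj S (S.eqn i) → Obj S (Constructor.cls i)
  | inl (A B : Constructor S.Idx) : Obj S A → Obj S (Constructor.sum A B)
  | inr (A B : Constructor S.Idx) : Obj S B → Obj S (Constructor.sum A B)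
  | pair (A B : Constructor S.Idx) : Obj S A → Obj S B → Obj S (Constructor.prod A B)
  | seqNil (A : Constructor S.Idx) : Obj S (Constructor.seq A)
  | seqCons (A : Constructor S.Idx) :
      Obj S A → Obj S (Constructor.seq A) → Obj S (Constructor.seq A)

/-- The atoms of an object, in left-to-right reading order. The size of the object is the length of
this word. -/
def Obj.word {S : Specification} : {A : Constructor S.Idx} → Obj S A → List Atom
  | _, .neutral => []
  | _, .atom a => [a]
  | _, .cls _ d => d.word
  | _, .inl _ _ d => d.word
  | _, .inr _ _ d => d.word
  | _, .pair _ _ d d' => d.word ++ d'.word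
  | _, .seqNil _ => []
  | _, .seqCons _ d d' => d.word ++ d'.word

/-- `Seq` is applied only to classes that have no object of size zero. -/
def SeqProper (S : Specification) : Constructor S.Idx → Prop
  | .neutral => True
  | .atom _ => True
  | .cls _ => True
  | .sum a b => SeqProper S a ∧ SeqProper S b
  | .prod a b => SeqProper S a ∧ SeqProper S b
  | .seq a => SeqProper S a ∧ ∀ d : Obj S a, d.word ≠ []

/-- All classes of the system are combinatorial classes (finitely many objects of each size), and
`Seq` is only used where it is an admissible operation. -/
def IsAdmissible (S : Specification) : Prop :=
  (∀ (i : S.Idx) (n : ℕ),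
      {d : Obj S (Constructor.cls i) | d.word.length = n}.Finite) ∧
    ∀ i : S.Idx, SeqProper S (S.eqn i)

/-- `S` is a bottom-to-top specification for `C` which tracks the leftmost entry if `trackL` is
true and the rightmost entry if `trackR` is true: the objects of the class specified by `S`
correspond bijectively to the permutations in `C`, in such a way that the atoms of an object, in
reading order, are the entries of the corresponding permutation, from bottom to top. -/
def IsBottomToTopFor (S : Specification) (trackL trackR : Bool) (C : Set Permutation) : Prop :=
  S.IsAdmissible ∧
    ∃ e : Obj S (Constructor.cls S.start) ≃ C,
      ∀ d, d.word = Permutation.bottomToTop trackL trackR (e d : Permutation)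

/-- `S` is a specification for `C` that tracks the rightmost entry. -/
def TracksRight (S : Specification) (C : Set Permutation) : Prop :=
  S.IsBottomToTopFor false true C

/-- `S` is a specification for `C` that tracks the leftmost entry. -/
def TracksLeft (S : Specification) (C : Set Permutation) : Prop :=
  S.IsBottomToTopFor true false C

/-- `S` is a specification for `C` that tracks both the leftmost and the rightmost entries. -/
def TracksBoth (S : Specification) (C : Set Permutation) : Prop :=
  S.IsBottomToTopFor true true C

/-- Context-free: only `+` and `×` are used. -/
def IsContextFree (S : Specification) : Prop :=
  ∀ i : S.Idx, (S.eqn i).SeqFree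

/-- Regular: the right-hand sides are built from atoms (and `ℰ`) by `+`, `×` and `Seq`. -/
def IsRegular (S : Specification) : Prop :=
  ∀ i : S.Idx, (S.eqn i).ClassFree

/-- The three sorts of specifications. -/
inductive Kind : Type
  | arbitrary
  | contextFree
  | regular

/-- `S` is a specification of the given sort. -/
def HasKind (S : Specification) : Kind → Prop
  | .arbitrary => True
  | .contextFree => S.IsContextFree
  | .regular => S.IsRegular

end Specification

/-!
Why the theorem is true. By turning permutations upside down (which reverses all words) and by
reading them from right to left (which exchanges the marks `ZL` and `ZR`), everything reduces to
`C ∣ Av(21)` with the rightmost entry tracked and the leftmost entry tracked or not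
(`Specification.exists_juxtapose_right`, `Specification.exists_juxtapose_left`).

A permutation in `C ∣ Av(21)` is empty, or increasing, or it consists of a nonempty `σ ∈ C` and a
nonempty increasing sequence that cannot be extended to the left, i.e. whose first entry lies below
the last entry of `σ`; `σ` is then unique, and it is in `C` because `C` is closed downwards
(`Permutation.mem_juxtapose_increasing_iff`). The first entry of the increasing sequence is its lowest
one. So the bottom-to-top words of these permutations arise from the word of `σ` by inserting new
atoms in all possible ways, at least one of them before `ZR`; the old `ZR` becomes `Z`, and the last
new atom becomes `ZR` (`Insertion.permCls_juxtapose`).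

The insertion is performed by an automaton with three states (no, some, all new atoms have been
inserted), which can be pushed through all constructors: a class symbol `i` becomes nine symbols, one
for each pair of states, `×` becomes matrix multiplication, and `Seq` becomes the star of an upper
triangular matrix, which is again expressed by `+`, `×` and `Seq` (`Insertion.den_expr`). Arbitrarily
many new atoms between two old ones need `Seq(Z)`, or in the context-free case a symbol with equation
`N = ℰ + Z × N`.

To keep track of multiplicities, classes are considered up to weight-preserving bijection; they form a
semiring `Cls`, in which the calculations take place. An automaton is a homomorphism from words to
matrices over `Cls`, and it extends to a homomorphism from classes to matrices over `Cls`
(`Cls.lift`). That a family of classes is the least solution of a system of equations is verified with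
the help of markers for the unfolded equations: the equations with markers have only one solution
(`Specification.objCls_eq_den_of_solution`).

In the regular case there are no class symbols, except for the one of the empty class, which can be
eliminated from an expression (`Insertion.exists_classFree`).
-/

/-! ### Weighted classes up to weight-preserving bijection -/

/-- A combinatorial class: a type of objects, each with a weight in `M`. -/
structure WClass (M : Type) : Type 1 where
  /-- the objects -/
  carrier : Type
  /-- the weight of an object -/
  wt : carrier → M

/-- Two classes are identified when there is a weight-preserving bijection between them. -/
instance WClass.setoid (M : Type) : Setoid (WClass M) where
  r X Y := ∃ e : X.carrier ≃ Y.carrier, ∀ x, Y.wt (e x) = X.wt x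
  iseqv :=
    { refl := fun _ => ⟨Equiv.refl _, fun _ => rfl⟩
      symm := fun ⟨e, h⟩ => ⟨e.symm, fun y => by rw [← h, e.apply_symm_apply]⟩
      trans := fun ⟨e, h⟩ ⟨e', h'⟩ => ⟨e.trans e', fun x => by simp [h, h']⟩ }

/-- Combinatorial classes up to weight-preserving bijection. For a monoid `M` of weights they form a
semiring, with disjoint union as sum and Cartesian product as product. -/
def Cls (M : Type) : Type 1 := Quotient (WClass.setoid M)

namespace Cls

variable {M M' : Type}

/-- The isomorphism type of a class, given by the weights of its objects. -/
def mk {X : Type} (w : X → M) : Cls M := Quotient.mk _ ⟨X, w⟩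

theorem mk_eq_mk {X Y : Type} {w : X → M} {w' : Y → M} :
    mk w = mk w' ↔ ∃ e : X ≃ Y, ∀ x, w' (e x) = w x :=
  Quotient.eq (r := WClass.setoid M)

theorem mk_congr {X Y : Type} {w : X → M} {w' : Y → M} (e : X ≃ Y) (h : ∀ x, w' (e x) = w x) :
    mk w = mk w' := mk_eq_mk.2 ⟨e, h⟩

theorem mk_congr_of_bijective {X Y : Type} {w : X → M} {w' : Y → M} (f : X → Y)
    (hf : Function.Bijective f) (h : ∀ x, w' (f x) = w x) : mk w = mk w' :=
  mk_congr (Equiv.ofBijective f hf) h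

theorem exists_mk (x : Cls M) : ∃ (X : Type) (w : X → M), x = mk w := by
  induction x using Quotient.inductionOn with
  | h X => exact ⟨X.carrier, X.wt, rfl⟩

/-- The class with a single object, of weight `m`. -/
def single (m : M) : Cls M := mk fun _ : Unit => m

/-- The disjoint union of a family of classes. -/
noncomputable def sig {I : Type} (f : I → Cls M) : Cls M :=
  mk fun p : Σ i, (Quotient.out (f i)).carrier => (Quotient.out (f p.1)).wt p.2

theorem sig_mk {I : Type} {X : I → Type} (w : ∀ i, X i → M) :
    sig (fun i => mk (w i)) = mk fun p : Σ i, X i => w p.1 p.2 := by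
  have h : ∀ i, ∃ e : (Quotient.out (mk (w i))).carrier ≃ X i,
      ∀ x, w i (e x) = (Quotient.out (mk (w i))).wt x := fun i =>
    mk_eq_mk.1 (show mk (Quotient.out (mk (w i))).wt = mk (w i) from Quotient.out_eq _)
  choose e he using h
  exact mk_congr (Equiv.sigmaCongrRight e) fun x => he x.1 x.2

theorem exists_mk_family {I : Type} (f : I → Cls M) :
    ∃ (X : I → Type) (w : ∀ i, X i → M), f = fun i => mk (w i) := by
  choose X w h using fun i => exists_mk (f i)
  exact ⟨X, w, funext h⟩

instance : Zero (Cls M) := ⟨mk (fun x : Empty => x.elim)⟩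

instance : Add (Cls M) :=
  ⟨Quotient.map₂ (fun X Y => ⟨X.carrier ⊕ Y.carrier, Sum.elim X.wt Y.wt⟩) (by
    rintro X X' ⟨e, h⟩ Y Y' ⟨e', h'⟩
    refine ⟨Equiv.sumCongr e e', ?_⟩
    rintro (x | y)
    · exact h x
    · exact h' y)⟩

theorem mk_add {X Y : Type} (w : X → M) (w' : Y → M) : mk w + mk w' = mk (Sum.elim w w') := rfl

theorem zero_eq_mk {X : Type} [IsEmpty X] (w : X → M) : (0 : Cls M) = mk w :=
  mk_congr (Equiv.equivOfIsEmpty _ _) fun x => x.elim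

theorem eq_zero_of_isEmpty {X : Type} (w : X → M) (h : IsEmpty X) : mk w = 0 :=
  (zero_eq_mk w).symm

theorem isEmpty_of_mk_eq_zero {X : Type} {w : X → M} (h : mk w = 0) : IsEmpty X := by
  obtain ⟨e, -⟩ := mk_eq_mk.1 (h : mk w = mk (fun x : Empty => x.elim))
  exact e.isEmpty

theorem sig_add {I : Type} (f g : I → Cls M) : sig (fun i => f i + g i) = sig f + sig g := by
  obtain ⟨X, u, rfl⟩ := exists_mk_family f
  obtain ⟨Y, v, rfl⟩ := exists_mk_family g
  simp only [mk_add, sig_mk]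
  refine mk_congr (Equiv.sigmaSumDistrib X Y) ?_
  rintro ⟨i, x | x⟩ <;> rfl

theorem sig_sum {I J : Type} (f : I ⊕ J → Cls M) :
    sig f = sig (fun i => f (.inl i)) + sig fun j => f (.inr j) := by
  obtain ⟨X, u, rfl⟩ := exists_mk_family f
  simp only [mk_add, sig_mk]
  refine mk_congr (Equiv.sumSigmaDistrib X) ?_
  rintro ⟨i | i, x⟩ <;> rfl

theorem sig_equiv {I J : Type} (e : I ≃ J) (f : I → Cls M) (g : J → Cls M)
    (h : ∀ i, g (e i) = f i) : sig f = sig g := by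
  obtain ⟨Y, v, rfl⟩ := exists_mk_family g
  obtain rfl : f = fun i => mk (v (e i)) := funext fun i => (h i).symm
  simp only [sig_mk]
  exact mk_congr (Equiv.sigmaCongrLeft (β := Y) e) fun _ => rfl

theorem sig_unique {I : Type} [Unique I] (f : I → Cls M) : sig f = f default := by
  obtain ⟨Y, v, rfl⟩ := exists_mk_family f
  simp only [sig_mk]
  exact mk_congr (Equiv.uniqueSigma Y) fun p => by
    obtain ⟨i, x⟩ := p
    obtain rfl := Unique.eq_default i
    rfl

theorem sig_zero {I : Type} : sig (fun _ : I => (0 : Cls M)) = 0 := by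
  change sig (fun _ : I => mk (fun x : Empty => (x.elim : M))) = 0
  rw [sig_mk]
  exact eq_zero_of_isEmpty _ ⟨fun p => p.2.elim⟩

theorem sig_isEmpty {I : Type} [IsEmpty I] (f : I → Cls M) : sig f = 0 :=
  eq_zero_of_isEmpty _ ⟨fun p => isEmptyElim p.1⟩

/-- Replace every object of a class by the objects of a class that depends on its weight. -/
noncomputable def bind (φ : M → Cls M') (x : Cls M) : Cls M' :=
  Quotient.lift (fun X : WClass M => sig fun a => φ (X.wt a)) (by
    rintro X X' ⟨e, h⟩
    exact sig_equiv e _ _ fun i => by rw [h]) x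

theorem bind_mk {X : Type} (φ : M → Cls M') (w : X → M) :
    bind φ (mk w) = sig fun a => φ (w a) := rfl

theorem bind_single (φ : M → Cls M') (m : M) : bind φ (single m) = φ m := by
  rw [single, bind_mk, sig_unique]

theorem bind_add (φ : M → Cls M') (x y : Cls M) : bind φ (x + y) = bind φ x + bind φ y := by
  obtain ⟨X, u, rfl⟩ := exists_mk x
  obtain ⟨Y, v, rfl⟩ := exists_mk y
  simp only [mk_add, bind_mk, sig_sum, Sum.elim_inl, Sum.elim_inr]

theorem bind_zero (φ : M → Cls M') : bind φ 0 = (0 : Cls M') :=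
  sig_isEmpty (I := Empty) _

section Monoid

variable [Monoid M] [Monoid M']

instance : One (Cls M) := ⟨single 1⟩

instance : Mul (Cls M) :=
  ⟨Quotient.map₂ (fun X Y => ⟨X.carrier × Y.carrier, fun p => X.wt p.1 * Y.wt p.2⟩) (by
    rintro X X' ⟨e, h⟩ Y Y' ⟨e', h'⟩
    exact ⟨Equiv.prodCongr e e', fun p => by simp [h, h']⟩)⟩

theorem mk_mul {X Y : Type} (w : X → M) (w' : Y → M) :
    mk w * mk w' = mk fun p : X × Y => w p.1 * w' p.2 := rfl

theorem one_eq : (1 : Cls M) = single 1 := rfl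

noncomputable instance : Semiring (Cls M) where
  add_assoc x y z := by
    obtain ⟨X, u, rfl⟩ := exists_mk x
    obtain ⟨Y, v, rfl⟩ := exists_mk y
    obtain ⟨Z, w, rfl⟩ := exists_mk z
    simp only [mk_add]
    refine mk_congr (Equiv.sumAssoc X Y Z) ?_
    rintro ((x | x) | x) <;> rfl
  zero_add x := by
    obtain ⟨X, u, rfl⟩ := exists_mk x
    refine (mk_congr (Equiv.emptySum Empty X).symm ?_).symm
    intro x; rfl
  add_zero x := by
    obtain ⟨X, u, rfl⟩ := exists_mk x
    refine (mk_congr (Equiv.sumEmpty X Empty).symm ?_).symm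
    intro x; rfl
  add_comm x y := by
    obtain ⟨X, u, rfl⟩ := exists_mk x
    obtain ⟨Y, v, rfl⟩ := exists_mk y
    refine mk_congr (Equiv.sumComm X Y) ?_
    rintro (x | x) <;> rfl
  nsmul := nsmulRec
  left_distrib x y z := by
    obtain ⟨X, u, rfl⟩ := exists_mk x
    obtain ⟨Y, v, rfl⟩ := exists_mk y
    obtain ⟨Z, w, rfl⟩ := exists_mk z
    simp only [mk_add, mk_mul]
    refine mk_congr (Equiv.prodSumDistrib X Y Z) ?_
    rintro ⟨x, y | y⟩ <;> rfl
  right_distrib x y z := by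
    obtain ⟨X, u, rfl⟩ := exists_mk x
    obtain ⟨Y, v, rfl⟩ := exists_mk y
    obtain ⟨Z, w, rfl⟩ := exists_mk z
    simp only [mk_add, mk_mul]
    refine mk_congr (Equiv.sumProdDistrib X Y Z) ?_
    rintro ⟨x | x, y⟩ <;> rfl
  zero_mul x := by
    obtain ⟨X, u, rfl⟩ := exists_mk x
    exact eq_zero_of_isEmpty (fun p : Empty × X => (p.1.elim : M) * u p.2) inferInstance
  mul_zero x := by
    obtain ⟨X, u, rfl⟩ := exists_mk x
    exact eq_zero_of_isEmpty (fun p : X × Empty => u p.1 * (p.2.elim : M)) inferInstance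
  mul_assoc x y z := by
    obtain ⟨X, u, rfl⟩ := exists_mk x
    obtain ⟨Y, v, rfl⟩ := exists_mk y
    obtain ⟨Z, w, rfl⟩ := exists_mk z
    simp only [mk_mul]
    exact mk_congr (Equiv.prodAssoc X Y Z) fun p => by simp [mul_assoc]
  one_mul x := by
    obtain ⟨X, u, rfl⟩ := exists_mk x
    exact mk_congr (Equiv.punitProd X) fun p => by simp
  mul_one x := by
    obtain ⟨X, u, rfl⟩ := exists_mk x
    exact mk_congr (Equiv.prodPUnit X) fun p => by simp

theorem single_mul (m m' : M) : single (m * m') = single m * single m' :=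
  mk_congr (Equiv.punitProd Unit).symm fun _ => rfl

/-- Finite sequences of objects of a class, weighted by the product of the weights. -/
noncomputable def star (x : Cls M) : Cls M :=
  Quotient.map (fun X : WClass M => (⟨List X.carrier, fun l => (l.map X.wt).prod⟩ : WClass M)) (by
    rintro X X' ⟨e, h⟩
    refine ⟨Equiv.listEquivOfEquiv e, fun l => ?_⟩
    simp only [Equiv.listEquivOfEquiv, Equiv.coe_fn_mk, List.map_map]
    congr 2
    exact funext h) x

theorem star_mk {X : Type} (w : X → M) : star (mk w) = mk fun l : List X => (l.map w).prod := rfl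

/-- A nonempty sequence has a first term. -/
theorem star_eq (x : Cls M) : star x = 1 + x * star x := by
  obtain ⟨X, u, rfl⟩ := exists_mk x
  refine (mk_congr_of_bijective
    (Sum.elim (fun _ => []) fun p => p.1 :: p.2 : Unit ⊕ (X × List X) → List X) ⟨?_, ?_⟩ ?_).symm
  · rintro (a | ⟨a, l⟩) (b | ⟨b, l'⟩) h <;> simp_all
  · rintro (_ | ⟨a, l⟩)
    · exact ⟨.inl (), rfl⟩
    · exact ⟨.inr (a, l), rfl⟩
  · rintro (a | ⟨a, l⟩)
    · rfl
    · simp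

theorem star_single (m : M) : star (single m) = mk fun k : ℕ => m ^ k :=
  mk_congr_of_bijective (fun l : List Unit => l.length)
    ⟨fun l l' h => List.ext_getElem h fun _ _ _ => rfl, fun k => ⟨List.replicate k (), by simp⟩⟩
    fun l => by simp

theorem sig_prod {I J : Type} (f : I → Cls M) (g : J → Cls M) :
    (sig fun p : I × J => f p.1 * g p.2) = sig f * sig g := by
  obtain ⟨X, u, rfl⟩ := exists_mk_family f
  obtain ⟨Y, v, rfl⟩ := exists_mk_family g
  simp only [mk_mul, sig_mk]
  exact mk_congr
    ⟨fun p => (⟨p.1.1, p.2.1⟩, ⟨p.1.2, p.2.2⟩), fun p => ⟨(p.1.1, p.2.1), (p.1.2, p.2.2)⟩,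
      fun _ => rfl, fun _ => rfl⟩ fun _ => rfl

theorem sig_finset_sum {I J : Type} (s : Finset J) (f : I → J → Cls M) :
    sig (fun i => ∑ j ∈ s, f i j) = ∑ j ∈ s, sig fun i => f i j := by
  classical
  induction s using Finset.induction_on with
  | empty => simp [sig_zero]
  | insert j s hj ih => simp only [Finset.sum_insert hj, sig_add, ih]

/-- A monoid homomorphism into matrices of classes extends to a homomorphism of semirings. -/
noncomputable def lift {Q : Type} [Fintype Q] [DecidableEq Q]
    (φ : M →* Matrix Q Q (Cls M')) : Cls M →+* Matrix Q Q (Cls M') where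
  toFun x := Matrix.of fun p q => bind (fun m => φ m p q) x
  map_zero' := by ext p q : 2; exact bind_zero fun m => φ m p q
  map_one' := by ext p q : 2; simp [one_eq, bind_single, φ.map_one]
  map_add' x y := by ext p q : 2; exact bind_add (fun m => φ m p q) x y
  map_mul' x y := by
    ext p q : 2
    obtain ⟨X, u, rfl⟩ := exists_mk x
    obtain ⟨Y, v, rfl⟩ := exists_mk y
    simp only [mk_mul, Matrix.of_apply, bind_mk, map_mul, Matrix.mul_apply, sig_finset_sum]
    exact Finset.sum_congr rfl fun r _ =>
      sig_prod (fun a => φ (u a) p r) fun b => φ (v b) r q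

theorem lift_mk {Q X : Type} [Fintype Q] [DecidableEq Q] (φ : M →* Matrix Q Q (Cls M'))
    (w : X → M) (p q : Q) : lift φ (mk w) p q = sig fun a => φ (w a) p q := rfl

theorem lift_single {Q : Type} [Fintype Q] [DecidableEq Q] (φ : M →* Matrix Q Q (Cls M'))
    (m : M) : lift φ (single m) = φ m := by
  ext p q : 2
  exact bind_single (fun m => φ m p q) m

/-- Apply a homomorphism to all weights. -/
noncomputable def map (f : M →* M') : Cls M →+* Cls M' where
  toFun := Quotient.map (fun X => ⟨X.carrier, fun a => f (X.wt a)⟩) (by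
    rintro X X' ⟨e, h⟩
    exact ⟨e, fun x => by simp [h]⟩)
  map_zero' := mk_congr (Equiv.refl _) fun x => x.elim
  map_one' := mk_congr (Equiv.refl _) fun _ => f.map_one.symm
  map_add' x y := by
    obtain ⟨X, u, rfl⟩ := exists_mk x
    obtain ⟨Y, v, rfl⟩ := exists_mk y
    refine mk_congr (Equiv.refl (X ⊕ Y)) ?_
    rintro (x | x) <;> rfl
  map_mul' x y := by
    obtain ⟨X, u, rfl⟩ := exists_mk x
    obtain ⟨Y, v, rfl⟩ := exists_mk y
    exact mk_congr (Equiv.refl (X × Y)) fun p => (f.map_mul _ _).symm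

theorem map_mk {X : Type} (f : M →* M') (w : X → M) : map f (mk w) = mk fun a => f (w a) := rfl

theorem map_single (f : M →* M') (m : M) : map f (single m) = single (f m) := rfl

theorem map_star (f : M →* M') (x : Cls M) : map f (star x) = star (map f x) := by
  obtain ⟨X, u, rfl⟩ := exists_mk x
  refine mk_congr (Equiv.refl (List X)) fun l => ?_
  simp [map_list_prod, Function.comp_def]

theorem map_sig {I : Type} (f : M →* M') (g : I → Cls M) :
    map f (sig g) = sig fun i => map f (g i) := by
  obtain ⟨X, u, rfl⟩ := exists_mk_family g
  simp only [sig_mk, map_mk]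

theorem map_lift {N N' Q : Type} [Monoid N] [Monoid N'] [Fintype Q] [DecidableEq Q]
    (φ : M →* Matrix Q Q (Cls N)) (ψ : M' →* Matrix Q Q (Cls N')) (f : M →* M') (g : N →* N')
    (h : ∀ m p q, map g (φ m p q) = ψ (f m) p q) (x : Cls M) (p q : Q) :
    map g (lift φ x p q) = lift ψ (map f x) p q := by
  obtain ⟨X, u, rfl⟩ := exists_mk x
  simp only [map_mk, lift_mk, map_sig, h]

end Monoid

end Cls

/-! ### Traces: words with markers for the unfolded equations -/

/-- A word in the atoms, in which the letter `none` stands for an unfolding of an equation of a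
specification. Plain words are the traces without the letter `none`. -/
abbrev Trace : Type := FreeMonoid (Option Atom)

namespace Trace

/-- The trace that consists of a single atom. -/
def atom (a : Atom) : Trace := FreeMonoid.of (some a)

/-- The trace that consists of a single unfolding. -/
def unfold : Trace := FreeMonoid.of none

/-- The number of atoms in a trace. -/
def size (m : Trace) : ℕ := (FreeMonoid.toList m).countP Option.isSome

/-- The number of unfoldings in a trace. -/
def depth (m : Trace) : ℕ := (FreeMonoid.toList m).countP Option.isNone

@[simp] theorem size_one : size 1 = 0 := rfl
@[simp] theorem depth_one : depth 1 = 0 := rfl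
@[simp] theorem size_atom (a : Atom) : size (atom a) = 1 := rfl
@[simp] theorem size_unfold : size unfold = 0 := rfl
@[simp] theorem depth_unfold : depth unfold = 1 := rfl

@[simp] theorem size_mul (m m' : Trace) : size (m * m') = size m + size m' := by
  simp [size, FreeMonoid.toList_mul]

@[simp] theorem depth_mul (m m' : Trace) : depth (m * m') = depth m + depth m' := by
  simp [depth, FreeMonoid.toList_mul]

@[simp] theorem size_pow (m : Trace) (k : ℕ) : size (m ^ k) = k * size m := by
  induction k with
  | zero => simp
  | succ k ih => rw [pow_succ, size_mul, ih]; ring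

/-- A plain word as a trace. -/
def ofWord (w : List Atom) : Trace := FreeMonoid.ofList (w.map some)

@[simp] theorem ofWord_nil : ofWord [] = 1 := rfl

theorem ofWord_cons (a : Atom) (w : List Atom) : ofWord (a :: w) = atom a * ofWord w := rfl

theorem ofWord_append (w w' : List Atom) : ofWord (w ++ w') = ofWord w * ofWord w' := by
  simp [ofWord, FreeMonoid.ofList_append]

theorem ofWord_injective : Function.Injective ofWord := fun _ _ h =>
  (Option.some_injective _).list_map (FreeMonoid.ofList.injective h)

/-- Erase the unfoldings from a trace. -/
def erase : Trace →* Trace :=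
  FreeMonoid.lift fun o => match o with
    | none => 1
    | some a => atom a

@[simp] theorem erase_atom (a : Atom) : erase (atom a) = atom a := by simp [erase, atom]
@[simp] theorem erase_unfold : erase unfold = 1 := by simp [erase, unfold]

theorem induction {P : Trace → Prop} (h1 : P 1) (hu : ∀ m, P m → P (unfold * m))
    (ha : ∀ a m, P m → P (atom a * m)) (m : Trace) : P m := by
  induction m using FreeMonoid.inductionOn' with
  | one => exact h1
  | of_mul o m ih =>
    cases o with
    | none => exact hu m ih
    | some a => exact ha a m ih

end Trace

namespace Cls

/-- Every object of the class has a weight with the property `P`. -/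
def All {M : Type} (P : M → Prop) (x : Cls M) : Prop :=
  ∀ ⦃X : Type⦄ (w : X → M), x = mk w → ∀ a, P (w a)

theorem all_mk {M X : Type} {P : M → Prop} {w : X → M} : All P (mk w) ↔ ∀ a, P (w a) := by
  refine ⟨fun h => h w rfl, fun h Y w' hw a => ?_⟩
  obtain ⟨e, he⟩ := mk_eq_mk.1 hw
  rw [← e.apply_symm_apply a, he]
  exact h _

theorem All.mono {M : Type} {P P' : M → Prop} {x : Cls M} (h : All P x)
    (hP : ∀ m, P m → P' m) : All P' x := fun _ w hw a => hP _ (h w hw a)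

/-- All objects have at least `k` atoms. -/
def MinSize (k : ℕ) (x : Cls Trace) : Prop := All (fun m => k ≤ m.size) x

/-- There are finitely many objects of each size. -/
def IsFin (x : Cls Trace) : Prop :=
  ∀ ⦃X : Type⦄ (w : X → Trace), x = mk w → ∀ n, {a | (w a).size ≤ n}.Finite

theorem isFin_mk {X : Type} {w : X → Trace} :
    IsFin (mk w) ↔ ∀ n, {a | (w a).size ≤ n}.Finite := by
  refine ⟨fun h => h w rfl, fun h Y w' hw n => ?_⟩
  obtain ⟨e, he⟩ := mk_eq_mk.1 hw
  refine ((h n).image e).subset fun a ha => ⟨e.symm a, ?_, e.apply_symm_apply a⟩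
  rwa [Set.mem_ofPred_eq, ← he, e.apply_symm_apply]

theorem minSize_zero (k : ℕ) : MinSize k 0 := all_mk.2 fun a => a.elim

theorem minSize_single {k : ℕ} {m : Trace} (h : k ≤ m.size) : MinSize k (single m) :=
  all_mk.2 fun _ => h

theorem MinSize.add {k : ℕ} {x y : Cls Trace} (hx : MinSize k x) (hy : MinSize k y) :
    MinSize k (x + y) := by
  obtain ⟨X, u, rfl⟩ := exists_mk x
  obtain ⟨Y, v, rfl⟩ := exists_mk y
  refine all_mk.2 ?_
  rintro (a | a)
  · exact all_mk.1 hx a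
  · exact all_mk.1 hy a

theorem MinSize.mul {k l : ℕ} {x y : Cls Trace} (hx : MinSize k x) (hy : MinSize l y) :
    MinSize (k + l) (x * y) := by
  obtain ⟨X, u, rfl⟩ := exists_mk x
  obtain ⟨Y, v, rfl⟩ := exists_mk y
  refine all_mk.2 fun p => ?_
  simpa using add_le_add (all_mk.1 hx p.1) (all_mk.1 hy p.2)

theorem minSize_zero_left (x : Cls Trace) : MinSize 0 x := fun _ _ _ _ => Nat.zero_le _

theorem minSize_sum {k : ℕ} {J : Type} (s : Finset J) {f : J → Cls Trace}
    (h : ∀ j, MinSize k (f j)) : MinSize k (∑ j ∈ s, f j) :=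
  Finset.sum_induction f (MinSize k) (fun _ _ => MinSize.add) (minSize_zero k) fun j _ => h j

theorem minSize_sig {k : ℕ} {I : Type} {f : I → Cls Trace} (h : ∀ i, MinSize k (f i)) :
    MinSize k (sig f) := by
  obtain ⟨X, w, rfl⟩ := exists_mk_family f
  rw [sig_mk]
  exact all_mk.2 fun p => all_mk.1 (h p.1) p.2

theorem isFin_zero : IsFin 0 := isFin_mk.2 fun _ => Set.toFinite _

theorem isFin_single (m : Trace) : IsFin (single m) := isFin_mk.2 fun _ => Set.toFinite _

theorem isFin_one : IsFin 1 := isFin_single 1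

theorem IsFin.add {x y : Cls Trace} (hx : IsFin x) (hy : IsFin y) : IsFin (x + y) := by
  obtain ⟨X, u, rfl⟩ := exists_mk x
  obtain ⟨Y, v, rfl⟩ := exists_mk y
  refine isFin_mk.2 fun n => ?_
  refine (((isFin_mk.1 hx n).image Sum.inl).union ((isFin_mk.1 hy n).image Sum.inr)).subset ?_
  rintro (a | a) ha
  · exact .inl ⟨a, ha, rfl⟩
  · exact .inr ⟨a, ha, rfl⟩

theorem IsFin.mul {x y : Cls Trace} (hx : IsFin x) (hy : IsFin y) : IsFin (x * y) := by
  obtain ⟨X, u, rfl⟩ := exists_mk x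
  obtain ⟨Y, v, rfl⟩ := exists_mk y
  refine isFin_mk.2 fun n => ((isFin_mk.1 hx n).prod (isFin_mk.1 hy n)).subset ?_
  rintro ⟨a, b⟩ h
  simp only [Set.mem_ofPred_eq, Trace.size_mul, Set.mem_prod] at h ⊢
  omega

theorem isFin_sum {J : Type} (s : Finset J) {f : J → Cls Trace} (h : ∀ j, IsFin (f j)) :
    IsFin (∑ j ∈ s, f j) :=
  Finset.sum_induction f IsFin (fun _ _ => IsFin.add) isFin_zero fun j _ => h j

theorem isFin_sig {I : Type} {f : I → Cls Trace} (g : I → ℕ) (hg : ∀ n, {i | g i ≤ n}.Finite)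
    (hmin : ∀ i, MinSize (g i) (f i)) (hfin : ∀ i, IsFin (f i)) : IsFin (sig f) := by
  obtain ⟨X, w, rfl⟩ := exists_mk_family f
  rw [sig_mk]
  refine isFin_mk.2 fun n => ?_
  refine ((hg n).biUnion fun i _ => (isFin_mk.1 (hfin i) n).image (Sigma.mk i)).subset ?_
  rintro ⟨i, a⟩ h
  exact Set.mem_biUnion (show g i ≤ n from (all_mk.1 (hmin i) a).trans h) ⟨a, h, rfl⟩

theorem isFin_star_single {m : Trace} (h : 1 ≤ m.size) : IsFin (star (single m)) := by
  rw [star_single]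
  refine isFin_mk.2 fun n => (Set.finite_le_nat n).subset fun k hk => ?_
  simp only [Set.mem_ofPred_eq, Trace.size_pow] at hk ⊢
  nlinarith

/-- Arden's rule: if no object of `x` has size zero then `star x * b` is the only solution of
`y = b + x * y`. -/
theorem eq_star_mul {x b y : Cls Trace} (hx : MinSize 1 x) (h : y = b + x * y) :
    y = star x * b := by
  obtain ⟨X, u, rfl⟩ := exists_mk x
  obtain ⟨B, v, rfl⟩ := exists_mk b
  obtain ⟨Y, w, rfl⟩ := exists_mk y
  replace hx := all_mk.1 hx
  rw [mk_mul, mk_add, mk_eq_mk] at h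
  obtain ⟨e, he⟩ := h
  let g : List X → B → Y := fun l b =>
    l.foldr (fun a y => e.symm (.inr (a, y))) (e.symm (.inl b))
  have hnil : ∀ b, e (g [] b) = .inl b := fun b => e.apply_symm_apply _
  have hcons : ∀ a l b, e (g (a :: l) b) = .inr (a, g l b) := fun a l b => e.apply_symm_apply _
  refine (mk_congr_of_bijective (fun p : List X × B => g p.1 p.2) ⟨?_, ?_⟩ ?_).symm
  · rintro ⟨l, b⟩ ⟨l', b'⟩ hg
    simp only at hg
    induction l generalizing l' with
    | nil =>
      have := congrArg e hg
      cases l' with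
      | nil =>
        rw [hnil, hnil, Sum.inl.injEq] at this
        rw [this]
      | cons a' l' => rw [hnil, hcons] at this; cases this
    | cons a l ih =>
      have := congrArg e hg
      cases l' with
      | nil => rw [hnil, hcons] at this; cases this
      | cons a' l' =>
        simp only [hcons, Sum.inr.injEq, Prod.mk.injEq] at this
        have h2 := ih l' this.2
        simp_all
  · have key : ∀ n y, (w y).size ≤ n → ∃ p : List X × B, g p.1 p.2 = y := by
      intro n
      induction n with
      | zero =>
        intro y hy
        have h1 := he y
        rcases hey : e y with b | ⟨a, y'⟩
        · exact ⟨([], b), e.injective (by rw [hnil, hey])⟩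
        · rw [hey] at h1
          have := hx a
          simp only [Sum.elim_inr] at h1
          rw [← h1, Trace.size_mul] at hy
          omega
      | succ n ih =>
        intro y hy
        have h1 := he y
        rcases hey : e y with b | ⟨a, y'⟩
        · exact ⟨([], b), e.injective (by rw [hnil, hey])⟩
        · rw [hey] at h1
          have := hx a
          simp only [Sum.elim_inr] at h1
          rw [← h1, Trace.size_mul] at hy
          obtain ⟨⟨l, b⟩, hp⟩ := ih y' (by omega)
          exact ⟨(a :: l, b), e.injective (by rw [hcons, hey, hp])⟩
    exact fun y => key _ y le_rfl
  · rintro ⟨l, b⟩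
    simp only
    induction l with
    | nil => rw [← he, hnil]; simp
    | cons a l ih => rw [← he, hcons]; simp [ih, mul_assoc]

end Cls

/-! ### The least solution of a specification -/

namespace Specification

open Cls

/-- The value of an expression when the class symbols are interpreted by the classes `Y i`. -/
noncomputable def den {ι : Type} (Y : ι → Cls Trace) : Constructor ι → Cls Trace
  | .neutral => 1
  | .atom a => single (Trace.atom a)
  | .cls i => Y i
  | .sum A B => den Y A + den Y B
  | .prod A B => den Y A * den Y B
  | .seq A => star (den Y A)

/-- The objects of an expression when the class symbols are interpreted by the types `X i`. -/
def DenType {ι : Type} (X : ι → Type) : Constructor ι → Type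
  | .neutral => Unit
  | .atom _ => Unit
  | .cls i => X i
  | .sum A B => DenType X A ⊕ DenType X B
  | .prod A B => DenType X A × DenType X B
  | .seq A => List (DenType X A)

/-- The weights of the objects in `DenType X A`. -/
def denWt {ι : Type} {X : ι → Type} (w : ∀ i, X i → Trace) :
    (A : Constructor ι) → DenType X A → Trace
  | .neutral => fun _ => 1
  | .atom a => fun _ => Trace.atom a
  | .cls i => w i
  | .sum A B => Sum.elim (denWt w A) (denWt w B)
  | .prod A B => fun p => denWt w A p.1 * denWt w B p.2
  | .seq A => fun l => (l.map (denWt w A)).prod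

theorem den_mk {ι : Type} {X : ι → Type} (w : ∀ i, X i → Trace) (A : Constructor ι) :
    den (fun i => Cls.mk (w i)) A = Cls.mk (denWt w A) := by
  induction A with
  | neutral => rfl
  | atom a => rfl
  | cls i => rfl
  | sum A B ihA ihB => rw [den, ihA, ihB]; rfl
  | prod A B ihA ihB => rw [den, ihA, ihB]; rfl
  | seq A ih => rw [den, ih]; rfl

variable {S : Specification}

/-- The atoms of an object together with the unfoldings of equations used to build it. Each
unfolding adds the trace `u` in front and the trace `v` behind. -/
def Obj.trace (u v : Trace) : {A : Constructor S.Idx} → Obj S A → Trace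
  | _, .neutral => 1
  | _, .atom a => Trace.atom a
  | _, .cls _ d => u * d.trace u v * v
  | _, .inl _ _ d => d.trace u v
  | _, .inr _ _ d => d.trace u v
  | _, .pair _ _ d d' => d.trace u v * d'.trace u v
  | _, .seqNil _ => 1
  | _, .seqCons _ d d' => d.trace u v * d'.trace u v

variable (S) in
/-- The class of objects of an expression, weighted by their traces. -/
def objCls (u v : Trace) (A : Constructor S.Idx) : Cls Trace := Cls.mk fun d : Obj S A => d.trace u v

variable (S) in
/-- The class of objects of an expression, weighted by their words. -/
def wordCls (A : Constructor S.Idx) : Cls Trace := Cls.mk fun d : Obj S A => Trace.ofWord d.word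

theorem Obj.erase_trace {u v : Trace} (hu : Trace.erase u = 1) (hv : Trace.erase v = 1)
    {A : Constructor S.Idx} (d : Obj S A) : Trace.erase (d.trace u v) = Trace.ofWord d.word := by
  induction d <;>
    simp_all [Obj.trace, Obj.word, Trace.ofWord_append, Trace.ofWord_cons]

theorem map_erase_objCls {u v : Trace} (hu : Trace.erase u = 1) (hv : Trace.erase v = 1)
    (A : Constructor S.Idx) : map Trace.erase (objCls S u v A) = wordCls S A := by
  rw [objCls, map_mk, wordCls]
  simp only [Obj.erase_trace hu hv]

theorem Obj.size_trace {u v : Trace} (hu : u.size = 0) (hv : v.size = 0)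
    {A : Constructor S.Idx} (d : Obj S A) : (d.trace u v).size = d.word.length := by
  induction d <;> simp_all [Obj.trace, Obj.word]

/-- A sequence of objects as an object of `Seq`. -/
def Obj.ofList {A : Constructor S.Idx} : List (Obj S A) → Obj S (.seq A)
  | [] => .seqNil A
  | d :: l => .seqCons A d (Obj.ofList l)

theorem Obj.ofList_bijective {A : Constructor S.Idx} :
    Function.Bijective (Obj.ofList : List (Obj S A) → Obj S (.seq A)) := by
  constructor
  · intro l l' h
    induction l generalizing l' with
    | nil =>
      cases l' with
      | nil => rfl
      | cons => simp [Obj.ofList] at h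
    | cons d l ih =>
      cases l' with
      | nil => simp [Obj.ofList] at h
      | cons d' l' =>
        simp only [Obj.ofList, Obj.seqCons.injEq] at h
        rw [h.1, ih h.2]
  · have key : ∀ (B) (d : Obj S B) (h : B = .seq A), ∃ l, Obj.ofList l = h ▸ d := by
      intro B d
      induction d with
      | seqNil A => rintro ⟨⟩; exact ⟨[], by simp [Obj.ofList]⟩
      | seqCons A d d' _ ih =>
        rintro ⟨⟩
        obtain ⟨l, hl⟩ := ih rfl
        exact ⟨d :: l, by simp [Obj.ofList, hl]⟩
      | _ => rintro ⟨⟩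
    exact fun d => key _ d rfl

theorem objCls_eq_den (u v : Trace) (A : Constructor S.Idx) :
    objCls S u v A = den (fun i => objCls S u v (.cls i)) A := by
  induction A with
  | neutral =>
    refine (mk_congr_of_bijective (fun _ : Unit => Obj.neutral) ⟨fun _ _ _ => rfl, ?_⟩ ?_).symm
    · rintro ⟨⟩; exact ⟨(), rfl⟩
    · intro; rfl
  | atom a =>
    refine (mk_congr_of_bijective (fun _ : Unit => Obj.atom a) ⟨fun _ _ _ => rfl, ?_⟩ ?_).symm
    · rintro ⟨⟩; exact ⟨(), rfl⟩
    · intro; rfl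
  | cls i => rfl
  | sum A B ihA ihB =>
    rw [den, ← ihA, ← ihB, objCls, objCls, objCls, mk_add]
    refine (mk_congr_of_bijective (Sum.elim (Obj.inl A B) (Obj.inr A B)) ⟨?_, ?_⟩ ?_).symm
    · rintro (d | d) (d' | d') h <;> simp_all
    · rintro (d | d)
      · exact ⟨.inl ‹_›, rfl⟩
      · exact ⟨.inr ‹_›, rfl⟩
    · rintro (d | d) <;> rfl
  | prod A B ihA ihB =>
    rw [den, ← ihA, ← ihB, objCls, objCls, objCls, mk_mul]
    refine (mk_congr_of_bijective (fun p => Obj.pair A B p.1 p.2) ⟨?_, ?_⟩ ?_).symm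
    · rintro ⟨d, d'⟩ ⟨f, f'⟩ h; simp_all
    · rintro ⟨⟩; exact ⟨(_, _), rfl⟩
    · intro; rfl
  | seq A ih =>
    rw [den, ← ih, objCls, objCls, star_mk]
    refine (mk_congr_of_bijective Obj.ofList Obj.ofList_bijective fun l => ?_).symm
    induction l with
    | nil => rfl
    | cons d l ih => simp only [Obj.ofList, Obj.trace, ih, List.map_cons, List.prod_cons]

theorem objCls_cls (u v : Trace) (i : S.Idx) :
    objCls S u v (.cls i) = single u * objCls S u v (S.eqn i) * single v := by
  rw [objCls, objCls, single, single, mk_mul, mk_mul]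
  refine (mk_congr_of_bijective (fun p => Obj.cls i p.1.2) ⟨?_, ?_⟩ ?_).symm
  · rintro ⟨⟨⟨⟩, d⟩, ⟨⟩⟩ ⟨⟨⟨⟩, d'⟩, ⟨⟩⟩ h; simp_all
  · rintro ⟨⟩; exact ⟨(((), _), ()), rfl⟩
  · intro; rfl

/-- The image of an object in a solution `X` of the system. -/
def Obj.fold {X : S.Idx → Type} (e : ∀ i, DenType X (S.eqn i) → X i) :
    {A : Constructor S.Idx} → Obj S A → DenType X A
  | _, .neutral => ()
  | _, .atom _ => ()
  | _, .cls i d => e i (d.fold e)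
  | _, .inl _ _ d => Sum.inl (d.fold e)
  | _, .inr _ _ d => Sum.inr (d.fold e)
  | _, .pair _ _ d d' => (d.fold e, d'.fold e)
  | _, .seqNil _ => ([] : List _)
  | _, .seqCons _ d d' => (d.fold e :: d'.fold e : List _)

theorem Obj.fold_injective {X : S.Idx → Type} {e : ∀ i, DenType X (S.eqn i) → X i}
    (he : ∀ i, Function.Injective (e i)) {A : Constructor S.Idx} (d d' : Obj S A)
    (h : d.fold e = d'.fold e) : d = d' := by
  induction d with
  | neutral => cases d'; rfl
  | atom a => cases d'; rfl
  | cls i d ih =>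
    cases d' with | cls _ d' => ?_
    rw [ih d' (he i h)]
  | inl A B d ih =>
    cases d' with
    | inl _ _ d' => rw [ih d' (Sum.inl_injective h)]
    | inr _ _ d' => cases h
  | inr A B d ih =>
    cases d' with
    | inl _ _ d' => cases h
    | inr _ _ d' => rw [ih d' (Sum.inr_injective h)]
  | pair A B d f ih ih' =>
    cases d' with | pair _ _ d' f' => ?_
    rw [ih d' (congrArg Prod.fst h), ih' f' (congrArg Prod.snd h)]
  | seqNil A => cases d' with
    | seqNil => rfl
    | seqCons _ d' f' => cases h
  | seqCons A d f ih ih' =>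
    cases d' with
    | seqNil => cases h
    | seqCons _ d' f' =>
      have h' := List.cons.inj h
      rw [ih d' h'.1, ih' f' h'.2]

/-- The system has only one solution in which every unfolding leaves a marker: objects of a solution
can be decomposed until no markers are left. -/
theorem objCls_eq_den_of_solution {u v : Trace} (huv : 1 ≤ u.depth + v.depth)
    (Y : S.Idx → Cls Trace) (hY : ∀ i, Y i = single u * den Y (S.eqn i) * single v)
    (A : Constructor S.Idx) : objCls S u v A = den Y A := by
  obtain ⟨X, w, rfl⟩ := exists_mk_family Y
  have h1 : ∀ i, ∃ e : DenType X (S.eqn i) ≃ X i, ∀ x, w i (e x) = u * denWt w _ x * v := by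
    intro i
    have h := hY i
    rw [den_mk, single, single, mk_mul, mk_mul] at h
    obtain ⟨e, he⟩ := mk_eq_mk.1 h
    refine ⟨((Equiv.punitProd _).symm.trans (Equiv.prodPUnit _).symm).trans e.symm, fun x => ?_⟩
    rw [← he]
    simp
  choose e he using h1
  rw [den_mk]
  refine mk_congr_of_bijective (Obj.fold fun i => e i)
    ⟨fun d d' => Obj.fold_injective (fun i => (e i).injective) d d', ?_⟩ ?_
  · have key : ∀ (n : ℕ) (A : Constructor S.Idx) (x : DenType X A), (denWt w A x).depth ≤ n →
        ∃ d : Obj S A, d.fold (fun i => e i) = x := by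
      intro n
      induction n using Nat.strong_induction_on with
      | _ n IH =>
      intro A
      induction A with
      | neutral => exact fun x _ => ⟨.neutral, rfl⟩
      | atom a => exact fun x _ => ⟨.atom a, rfl⟩
      | cls i =>
        intro x hx
        obtain ⟨y, rfl⟩ := (e i).surjective x
        simp only [denWt, he, Trace.depth_mul] at hx
        obtain ⟨d, rfl⟩ := IH (n - 1) (by omega) _ y (by omega)
        exact ⟨.cls i d, rfl⟩
      | sum A B ihA ihB =>
        rintro (x | x) hx
        · obtain ⟨d, rfl⟩ := ihA x hx
          exact ⟨.inl _ _ d, rfl⟩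
        · obtain ⟨d, rfl⟩ := ihB x hx
          exact ⟨.inr _ _ d, rfl⟩
      | prod A B ihA ihB =>
        rintro ⟨x, y⟩ hx
        simp only [denWt, Trace.depth_mul] at hx
        obtain ⟨d, rfl⟩ := ihA x (by omega)
        obtain ⟨d', rfl⟩ := ihB y (by omega)
        exact ⟨.pair _ _ d d', rfl⟩
      | seq A ih =>
        intro (l : List (DenType X A)) hl
        induction l with
        | nil => exact ⟨.seqNil A, rfl⟩
        | cons x l ihl =>
          simp only [denWt, List.map_cons, List.prod_cons, Trace.depth_mul] at hl
          obtain ⟨d, rfl⟩ := ih x (by omega)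
          obtain ⟨d', rfl⟩ := ihl (by simp only [denWt]; omega)
          exact ⟨.seqCons A d d', rfl⟩
    exact fun x => key _ A x le_rfl
  · intro d
    induction d with
    | cls i d ih => simp only [Obj.fold, denWt, he, ih, Obj.trace]
    | seqCons A d d' ih ih' =>
      rw [Obj.trace, ← ih, ← ih']
      rfl
    | seqNil A => rfl
    | _ => simp_all [Obj.fold, denWt, Obj.trace]

end Specification

/-! ### Admissibility in terms of classes -/

namespace Specification

open Cls

/-- `Seq` is applied only to expressions whose value has no object of size zero. -/
def SeqMin {ι : Type} (Y : ι → Cls Trace) : Constructor ι → Prop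
  | .neutral => True
  | .atom _ => True
  | .cls _ => True
  | .sum A B => SeqMin Y A ∧ SeqMin Y B
  | .prod A B => SeqMin Y A ∧ SeqMin Y B
  | .seq A => SeqMin Y A ∧ MinSize 1 (den Y A)

variable {S : Specification}

theorem minSize_objCls_iff {u v : Trace} (hu : u.size = 0) (hv : v.size = 0)
    (A : Constructor S.Idx) : MinSize 1 (objCls S u v A) ↔ ∀ d : Obj S A, d.word ≠ [] := by
  rw [objCls, MinSize, all_mk]
  refine forall_congr' fun d => ?_
  rw [Obj.size_trace hu hv, Nat.one_le_iff_ne_zero, Ne, List.length_eq_zero_iff]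

theorem seqProper_iff {u v : Trace} (hu : u.size = 0) (hv : v.size = 0)
    (A : Constructor S.Idx) :
    SeqProper S A ↔ SeqMin (fun i => objCls S u v (.cls i)) A := by
  induction A with
  | neutral => rfl
  | atom a => rfl
  | cls i => rfl
  | sum A B ihA ihB => rw [SeqProper, SeqMin, ihA, ihB]
  | prod A B ihA ihB => rw [SeqProper, SeqMin, ihA, ihB]
  | seq A ih => rw [SeqProper, SeqMin, ih, ← objCls_eq_den, minSize_objCls_iff hu hv]

theorem isFin_objCls_iff {u v : Trace} (hu : u.size = 0) (hv : v.size = 0)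
    (A : Constructor S.Idx) :
    IsFin (objCls S u v A) ↔ ∀ n, {d : Obj S A | d.word.length = n}.Finite := by
  rw [objCls, isFin_mk]
  simp only [Obj.size_trace hu hv]
  refine ⟨fun h n => (h n).subset fun d hd => le_of_eq hd, fun h n => ?_⟩
  refine ((Set.finite_le_nat n).biUnion fun k _ => h k).subset fun d hd => ?_
  exact Set.mem_biUnion (show d.word.length ≤ n from hd) rfl

theorem isAdmissible_iff {u v : Trace} (hu : u.size = 0) (hv : v.size = 0) :
    S.IsAdmissible ↔ (∀ i, IsFin (objCls S u v (.cls i))) ∧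
      ∀ i, SeqMin (fun i => objCls S u v (.cls i)) (S.eqn i) := by
  simp only [IsAdmissible, isFin_objCls_iff hu hv, seqProper_iff hu hv]

theorem isFin_objCls_eqn {u v : Trace} (hu : u.size = 0) (hv : v.size = 0) (i : S.Idx)
    (h : IsFin (objCls S u v (.cls i))) : IsFin (objCls S u v (S.eqn i)) := by
  rw [isFin_objCls_iff hu hv] at h ⊢
  exact fun n => ((h n).preimage (f := Obj.cls i) fun _ _ _ _ => by simp).subset fun d hd => hd

/-- Admissibility and the class of words can be read off from a solution with markers. -/
theorem admissible_and_wordCls_of_solution {u v : Trace} (hu : u.size = 0) (hv : v.size = 0)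
    (hu1 : Trace.erase u = 1) (hv1 : Trace.erase v = 1) (huv : 1 ≤ u.depth + v.depth)
    {Y : S.Idx → Cls Trace} (hY : ∀ i, Y i = single u * den Y (S.eqn i) * single v)
    (hfin : ∀ i, IsFin (Y i)) (hseq : ∀ i, SeqMin Y (S.eqn i)) :
    S.IsAdmissible ∧ ∀ i, wordCls S (.cls i) = map Trace.erase (Y i) := by
  have h := objCls_eq_den_of_solution huv Y hY
  have h1 : (fun i => objCls S u v (.cls i)) = Y := funext fun i => h (.cls i)
  refine ⟨(isAdmissible_iff hu hv).2 ⟨fun i => ?_, h1 ▸ hseq⟩, fun i => ?_⟩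
  · rw [h]; exact hfin i
  · rw [← map_erase_objCls hu1 hv1, h]; rfl

/-- The value of an expression without class symbols does not depend on the interpretation. -/
theorem den_congr_of_classFree {ι : Type} (Y : ι → Cls Trace) {A : Constructor ι}
    (hA : A.ClassFree) (Y' : ι → Cls Trace) :
    den Y A = den Y' A ∧ (SeqMin Y A → SeqMin Y' A) := by
  induction A with
  | neutral => exact ⟨rfl, id⟩
  | atom a => exact ⟨rfl, id⟩
  | cls i => exact hA.elim
  | sum A B ihA ihB =>
    obtain ⟨h1, h2⟩ := ihA hA.1
    obtain ⟨h3, h4⟩ := ihB hA.2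
    exact ⟨by rw [den, den, h1, h3], fun h => ⟨h2 h.1, h4 h.2⟩⟩
  | prod A B ihA ihB =>
    obtain ⟨h1, h2⟩ := ihA hA.1
    obtain ⟨h3, h4⟩ := ihB hA.2
    exact ⟨by rw [den, den, h1, h3], fun h => ⟨h2 h.1, h4 h.2⟩⟩
  | seq A ih =>
    obtain ⟨h1, h2⟩ := ih hA
    exact ⟨by rw [den, den, h1], fun h => ⟨h2 h.1, h1 ▸ h.2⟩⟩

end Specification

/-! ### Inserting an increasing sequence into a word -/

namespace Atom

/-- The atom represents the rightmost entry. -/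
def isRight : Atom → Bool
  | Z => false
  | ZL => false
  | ZR => true
  | ZLR => true

/-- The atom that remains when the entry is no longer the rightmost one. -/
def dropRight : Atom → Atom
  | Z => Z
  | ZL => ZL
  | ZR => Z
  | ZLR => ZL

end Atom

namespace Insertion

open Cls Specification

/-- The class of a single atom. -/
def letter (a : Atom) : Cls Trace := single (Trace.atom a)

/-- What the insertion produces when it reads the atom `a`: some new entries, then `a` itself. The
state records how many of the new entries have been inserted: none (`0`), some but not the highest
one (`1`), all (`2`). The highest new entry is the rightmost entry of the result. The rightmost entry
of the given word cannot be read in state `0`. The class `ν` stands for an arbitrary number of new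
entries. -/
noncomputable def step (ν : Cls Trace) (a : Atom) : Matrix (Fin 3) (Fin 3) (Cls Trace) :=
  !![if a.isRight then 0 else letter a, letter .Z * ν * letter a.dropRight,
      ν * letter .ZR * letter a.dropRight;
    0, ν * letter a.dropRight, ν * letter .ZR * letter a.dropRight;
    0, 0, letter a.dropRight]

/-- The insertion into a whole trace; markers are copied. -/
noncomputable def run (ν : Cls Trace) : Trace →* Matrix (Fin 3) (Fin 3) (Cls Trace) :=
  FreeMonoid.lift fun o => match o with
    | none => Matrix.diagonal fun _ => single Trace.unfold
    | some a => step ν a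

theorem run_atom (ν : Cls Trace) (a : Atom) : run ν (Trace.atom a) = step ν a := by
  simp [run, Trace.atom]

theorem run_unfold (ν : Cls Trace) :
    run ν Trace.unfold = Matrix.diagonal fun _ => single Trace.unfold := by
  simp [run, Trace.unfold]

/-- The state never decreases. -/
theorem run_blockTriangular (ν : Cls Trace) (m : Trace) : (run ν m).BlockTriangular id := by
  induction m using Trace.induction with
  | h1 => rw [map_one]; exact Matrix.blockTriangular_one
  | hu m ih =>
    rw [map_mul, run_unfold]
    exact (Matrix.blockTriangular_diagonal _).mul ih
  | ha a m ih =>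
    rw [map_mul, run_atom]
    refine Matrix.BlockTriangular.mul ?_ ih
    intro p q h
    fin_cases p <;> fin_cases q <;> first | rfl | simp at h

theorem lift_run_eq_zero (ν x : Cls Trace) {p q : Fin 3} (h : q < p) :
    lift (run ν) x p q = 0 := by
  obtain ⟨X, w, rfl⟩ := exists_mk x
  rw [lift_mk]
  simp only [run_blockTriangular ν _ h, sig_zero]

theorem minSize_run (ν : Cls Trace) (m : Trace) (p q : Fin 3) :
    MinSize m.size (run ν m p q) := by
  induction m using Trace.induction generalizing p q with
  | h1 => exact minSize_zero_left _
  | hu m ih =>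
    rw [map_mul, run_unfold, Matrix.diagonal_mul, Trace.size_mul]
    exact (minSize_single le_rfl).mul (ih p q)
  | ha a m ih =>
    rw [map_mul, run_atom, Matrix.mul_apply, Trace.size_mul]
    refine minSize_sum _ fun r => MinSize.mul ?_ (ih r q)
    have h : ∀ (x : Cls Trace) (b : Atom), MinSize 1 (x * letter b) := fun x b => by
      simpa [letter] using (minSize_zero_left x).mul
        (minSize_single (m := Trace.atom b) (k := 1) (by simp))
    have h' : ∀ b : Atom, MinSize 1 (letter b) := fun b => by simpa using h 1 b
    rw [Trace.size_atom]
    fin_cases p <;> fin_cases r <;>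
      simp only [step, Matrix.of_apply, Matrix.cons_val', Matrix.cons_val_zero,
        Matrix.cons_val_one, Matrix.cons_val, Fin.mk_one, Fin.zero_eta, Fin.reduceFinMk] <;>
      first
        | exact h _ _
        | exact h' _
        | exact minSize_zero _
        | (split_ifs; exacts [minSize_zero _, h' _])

theorem isFin_run {ν : Cls Trace} (hν : IsFin ν) (m : Trace) (p q : Fin 3) :
    IsFin (run ν m p q) := by
  induction m using Trace.induction generalizing p q with
  | h1 =>
    rw [map_one, Matrix.one_apply]
    split_ifs
    exacts [isFin_one, isFin_zero]
  | hu m ih =>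
    rw [map_mul, run_unfold, Matrix.diagonal_mul]
    exact (isFin_single _).mul (ih p q)
  | ha a m ih =>
    rw [map_mul, run_atom, Matrix.mul_apply]
    refine isFin_sum _ fun r => IsFin.mul ?_ (ih r q)
    have h : ∀ b : Atom, IsFin (letter b) := fun b => isFin_single _
    fin_cases p <;> fin_cases r <;>
      simp only [step, Matrix.of_apply, Matrix.cons_val', Matrix.cons_val_zero,
        Matrix.cons_val_one, Matrix.cons_val, Fin.mk_one, Fin.zero_eta, Fin.reduceFinMk] <;>
      first
        | exact ((h _).mul hν).mul (h _)
        | exact (hν.mul (h _)).mul (h _)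
        | exact hν.mul (h _)
        | exact h _
        | exact isFin_zero
        | (split_ifs; exacts [isFin_zero, h _])

theorem minSize_lift_run (ν : Cls Trace) {x : Cls Trace} {k : ℕ} (hx : MinSize k x)
    (p q : Fin 3) : MinSize k (lift (run ν) x p q) := by
  obtain ⟨X, w, rfl⟩ := exists_mk x
  rw [lift_mk]
  exact minSize_sig fun a => (minSize_run ν (w a) p q).mono fun m hm => (all_mk.1 hx a).trans hm

theorem isFin_lift_run {ν : Cls Trace} (hν : IsFin ν) {x : Cls Trace} (hx : IsFin x)
    (p q : Fin 3) : IsFin (lift (run ν) x p q) := by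
  obtain ⟨X, w, rfl⟩ := exists_mk x
  rw [lift_mk]
  exact isFin_sig (fun a => (w a).size) (isFin_mk.1 hx) (fun a => minSize_run ν (w a) p q)
    fun a => isFin_run hν (w a) p q

/-- The class symbols of the specification of a juxtaposition: the classes `i` of the given
specification with an insertion that leads from one state to another, the empty class, the class of
all words in the atom `Z`, and the class to be specified. -/
inductive Idx (ι : Type) : Type
  | run (i : ι) (p q : Fin 3)
  | bot
  | nat
  | start

instance (ι : Type) [Finite ι] : Finite (Idx ι) :=
  Finite.of_surjective (α := (ι × Fin 3 × Fin 3) ⊕ Fin 3)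
    (Sum.elim (fun x => .run x.1 x.2.1 x.2.2) ![.bot, .nat, .start]) (by
      rintro (⟨i, p, q⟩ | _ | _ | _)
      exacts [⟨.inl (i, p, q), rfl⟩, ⟨.inr 0, rfl⟩, ⟨.inr 1, rfl⟩, ⟨.inr 2, rfl⟩])

variable {ι : Type}

/-- The expressions for `Insertion.step`; `N` is an expression for the words in the atom `Z`. -/
def stepExpr (N : Constructor (Idx ι)) (a : Atom) :
    Matrix (Fin 3) (Fin 3) (Constructor (Idx ι)) :=
  !![if a.isRight then .cls .bot else .atom a, .prod (.prod (.atom .Z) N) (.atom a.dropRight),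
      .prod (.prod N (.atom .ZR)) (.atom a.dropRight);
    .cls .bot, .prod N (.atom a.dropRight), .prod (.prod N (.atom .ZR)) (.atom a.dropRight);
    .cls .bot, .cls .bot, .atom a.dropRight]

/-- The expressions for the star of an upper triangular matrix: a sequence of factors is cut where
the state changes. -/
def starExpr (X : Matrix (Fin 3) (Fin 3) (Constructor (Idx ι))) :
    Matrix (Fin 3) (Fin 3) (Constructor (Idx ι)) :=
  !![.seq (X 0 0), .prod (.seq (X 0 0)) (.prod (X 0 1) (.seq (X 1 1))),
      .prod (.seq (X 0 0)) (.sum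
        (.prod (X 0 1) (.prod (.seq (X 1 1)) (.prod (X 1 2) (.seq (X 2 2)))))
        (.prod (X 0 2) (.seq (X 2 2))));
    .cls .bot, .seq (X 1 1), .prod (.seq (X 1 1)) (.prod (X 1 2) (.seq (X 2 2)));
    .cls .bot, .cls .bot, .seq (X 2 2)]

/-- The expressions for the insertion into the objects of an expression. -/
def expr (N : Constructor (Idx ι)) : Constructor ι → Matrix (Fin 3) (Fin 3) (Constructor (Idx ι))
  | .neutral => Matrix.of fun p q => if p = q then .neutral else .cls .bot
  | .atom a => stepExpr N a
  | .cls i => Matrix.of fun p q => .cls (.run i p q)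
  | .sum A B => Matrix.of fun p q => .sum (expr N A p q) (expr N B p q)
  | .prod A B => Matrix.of fun p q => .sum
      (.sum (.prod (expr N A p 0) (expr N B 0 q)) (.prod (expr N A p 1) (expr N B 1 q)))
      (.prod (expr N A p 2) (expr N B 2 q))
  | .seq A => starExpr (expr N A)

section

variable {S : Specification} {N : Constructor (Idx S.Idx)} {Y : Idx S.Idx → Cls Trace}

/-- The insertion into a sequence solves a triangular system of linear equations. -/
theorem den_starExpr (hbot : Y .bot = 0) (ν : Cls Trace) {x : Cls Trace} (hx : MinSize 1 x)
    {X : Matrix (Fin 3) (Fin 3) (Constructor (Idx S.Idx))}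
    (hX : ∀ p q, den Y (X p q) = lift (run ν) x p q) (p q : Fin 3) :
    den Y (starExpr X p q) = lift (run ν) (star x) p q := by
  have hmin := fun p => minSize_lift_run ν hx p p
  have h : ∀ p q, lift (run ν) (star x) p q = (1 : Matrix (Fin 3) (Fin 3) (Cls Trace)) p q +
      ∑ r, lift (run ν) x p r * lift (run ν) (star x) r q := fun p q => by
    conv_lhs => rw [star_eq, map_add, map_mul, map_one]
    rw [Matrix.add_apply, Matrix.mul_apply]
  have h10 : lift (run ν) x 1 0 = 0 := lift_run_eq_zero _ _ (by decide)
  have h20 : lift (run ν) x 2 0 = 0 := lift_run_eq_zero _ _ (by decide)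
  have h21 : lift (run ν) x 2 1 = 0 := lift_run_eq_zero _ _ (by decide)
  have s10 : lift (run ν) (star x) 1 0 = 0 := lift_run_eq_zero _ _ (by decide)
  have s20 : lift (run ν) (star x) 2 0 = 0 := lift_run_eq_zero _ _ (by decide)
  have s21 : lift (run ν) (star x) 2 1 = 0 := lift_run_eq_zero _ _ (by decide)
  have e22 : lift (run ν) (star x) 2 2 = star (lift (run ν) x 2 2) * 1 := by
    refine eq_star_mul (hmin 2) ?_
    simpa [Fin.sum_univ_three, h20, h21] using h 2 2
  have e11 : lift (run ν) (star x) 1 1 = star (lift (run ν) x 1 1) * 1 := by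
    refine eq_star_mul (hmin 1) ?_
    simpa [Fin.sum_univ_three, h10, s21] using h 1 1
  have e00 : lift (run ν) (star x) 0 0 = star (lift (run ν) x 0 0) * 1 := by
    refine eq_star_mul (hmin 0) ?_
    simpa [Fin.sum_univ_three, s10, s20] using h 0 0
  have e12 : lift (run ν) (star x) 1 2 = star (lift (run ν) x 1 1) *
      (lift (run ν) x 1 2 * lift (run ν) (star x) 2 2) := by
    refine eq_star_mul (hmin 1) ?_
    simpa [Fin.sum_univ_three, h10, add_comm] using h 1 2
  have e01 : lift (run ν) (star x) 0 1 = star (lift (run ν) x 0 0) *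
      (lift (run ν) x 0 1 * lift (run ν) (star x) 1 1) := by
    refine eq_star_mul (hmin 0) ?_
    simpa [Fin.sum_univ_three, s21, add_comm] using h 0 1
  have e02 : lift (run ν) (star x) 0 2 = star (lift (run ν) x 0 0) *
      (lift (run ν) x 0 1 * lift (run ν) (star x) 1 2 +
        lift (run ν) x 0 2 * lift (run ν) (star x) 2 2) := by
    refine eq_star_mul (hmin 0) ?_
    have := h 0 2
    rw [Fin.sum_univ_three, Matrix.one_apply_ne (by decide), zero_add] at this
    refine this.trans ?_
    abel
  rw [mul_one] at e00 e11 e22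
  fin_cases p <;> fin_cases q <;>
    simp [starExpr, den, hX, hbot, s10, s20, s21, e00, e11, e22, e01, e12, e02]

theorem den_stepExpr (hbot : Y .bot = 0) (a : Atom) (p q : Fin 3) :
    den Y (stepExpr N a p q) = step (den Y N) a p q := by
  fin_cases p <;> fin_cases q <;> simp [stepExpr, step, den, hbot, letter]
  split_ifs <;> simp [den, hbot]

/-- The expressions for the insertion denote what the automaton makes of the given objects. -/
theorem den_expr (hbot : Y .bot = 0)
    (hrun : ∀ i p q, Y (.run i p q) =
      lift (run (den Y N)) (objCls S Trace.unfold 1 (.cls i)) p q)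
    {A : Constructor S.Idx} (hA : SeqProper S A) (p q : Fin 3) :
    den Y (expr N A p q) = lift (run (den Y N)) (objCls S Trace.unfold 1 A) p q := by
  induction A generalizing p q with
  | neutral =>
    rw [objCls_eq_den, den, map_one, Matrix.one_apply, expr, Matrix.of_apply]
    split_ifs <;> simp [den, hbot]
  | atom a =>
    rw [objCls_eq_den, den, lift_single, run_atom, expr, den_stepExpr hbot]
  | cls i => exact hrun i p q
  | sum A B ihA ihB =>
    rw [objCls_eq_den, den, ← objCls_eq_den, ← objCls_eq_den, map_add, Matrix.add_apply, expr,
      Matrix.of_apply, den, ihA hA.1, ihB hA.2]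
  | prod A B ihA ihB =>
    rw [objCls_eq_den, den, ← objCls_eq_den, ← objCls_eq_den, map_mul, Matrix.mul_apply, expr,
      Matrix.of_apply, Fin.sum_univ_three]
    simp only [den, ihA hA.1, ihB hA.2]
  | seq A ih =>
    rw [objCls_eq_den, den, ← objCls_eq_den, expr]
    exact den_starExpr hbot _ ((minSize_objCls_iff (by simp) (by simp) A).2 hA.2)
      (fun p q => ih hA.1 p q) p q

theorem seqMin_expr (hbot : Y .bot = 0)
    (hrun : ∀ i p q, Y (.run i p q) =
      lift (run (den Y N)) (objCls S Trace.unfold 1 (.cls i)) p q)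
    (hN : SeqMin Y N) {A : Constructor S.Idx} (hA : SeqProper S A) (p q : Fin 3) :
    SeqMin Y (expr N A p q) := by
  induction A generalizing p q with
  | neutral => rw [expr, Matrix.of_apply]; split_ifs <;> trivial
  | atom a =>
    fin_cases p <;> fin_cases q <;> simp [expr, stepExpr, SeqMin, hN]
    split_ifs <;> trivial
  | cls i => trivial
  | sum A B ihA ihB => exact ⟨ihA hA.1 p q, ihB hA.2 p q⟩
  | prod A B ihA ihB =>
    exact ⟨⟨⟨ihA hA.1 _ _, ihB hA.2 _ _⟩, ⟨ihA hA.1 _ _, ihB hA.2 _ _⟩⟩,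
      ⟨ihA hA.1 _ _, ihB hA.2 _ _⟩⟩
  | seq A ih =>
    have h : ∀ p q, MinSize 1 (den Y (expr N A p q)) := fun p q => by
      rw [den_expr hbot hrun hA.1]
      exact minSize_lift_run _ ((minSize_objCls_iff (by simp) (by simp) A).2 hA.2) p q
    fin_cases p <;> fin_cases q <;> simp [expr, starExpr, SeqMin, ih hA.1, h]

end

end Insertion

/-! ### The specification of the insertion -/

namespace Insertion

open Cls Specification

/-- The words of the nonempty increasing permutations, with the leftmost entry marked if `trackL`
is true; `ν` stands for the words in the atom `Z`. -/
noncomputable def monotoneCls (trackL : Bool) (ν : Cls Trace) : Cls Trace :=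
  if trackL then letter .ZLR + letter .ZL * (ν * letter .ZR) else ν * letter .ZR

/-- The words obtained from those of `x` by inserting an increasing sequence of new entries, at
least one of them below the rightmost entry, together with the words of the increasing
permutations. -/
noncomputable def insertionCls (trackL : Bool) (ν x : Cls Trace) : Cls Trace :=
  1 + (monotoneCls trackL ν + (lift (run ν) x 0 1 * (ν * letter .ZR) + lift (run ν) x 0 2))

variable {ι : Type}

/-- The expression for `Insertion.monotoneCls`. -/
def monotoneExpr (trackL : Bool) (N : Constructor (Idx ι)) : Constructor (Idx ι) :=
  if trackL then .sum (.atom .ZLR) (.prod (.atom .ZL) (.prod N (.atom .ZR)))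
  else .prod N (.atom .ZR)

/-- The expression for `Insertion.insertionCls`. -/
def startExpr (trackL : Bool) (N : Constructor (Idx ι)) (A : Constructor ι) :
    Constructor (Idx ι) :=
  .sum .neutral (.sum (monotoneExpr trackL N)
    (.sum (.prod (expr N A 0 1) (.prod N (.atom .ZR))) (expr N A 0 2)))

/-- The equations of the specification of the insertion. -/
def equation (S : Specification) (trackL : Bool) (N : Constructor (Idx S.Idx)) :
    Idx S.Idx → Constructor (Idx S.Idx)
  | .run i p q => expr N (S.eqn i) p q
  | .bot => .cls .bot
  | .nat => .sum .neutral (.prod (.atom .Z) (.cls .nat))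
  | .start => startExpr trackL N (S.eqn S.start)

/-- The specification of the insertion. -/
def spec (S : Specification) (trackL : Bool) (N : Constructor (Idx S.Idx)) : Specification where
  Idx := Idx S.Idx
  finite_idx := haveI := S.finite_idx; inferInstance
  start := .start
  eqn := equation S trackL N

/-- The solution of the equation `ν = ℰ + Z × ν` for the words in the atom `Z`. -/
noncomputable def natCls : Cls Trace :=
  single Trace.unfold * star (letter .Z * single Trace.unfold)

/-- The solution of the specification of the insertion. -/
noncomputable def solution (S : Specification) (trackL : Bool) (ν : Cls Trace) :
    Idx S.Idx → Cls Trace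
  | .run i p q => lift (run ν) (objCls S Trace.unfold 1 (.cls i)) p q
  | .bot => 0
  | .nat => natCls
  | .start => single Trace.unfold *
      insertionCls trackL ν (objCls S Trace.unfold 1 (S.eqn S.start))

section

variable {S : Specification} {trackL : Bool} {N : Constructor (Idx S.Idx)} {ν : Cls Trace}

theorem den_startExpr (hS : S.IsAdmissible) (hν : den (solution S trackL ν) N = ν) :
    den (solution S trackL ν) (startExpr trackL N (S.eqn S.start)) =
      insertionCls trackL ν (objCls S Trace.unfold 1 (S.eqn S.start)) := by
  have h := fun p q => den_expr (S := S) (N := N) (Y := solution S trackL ν) rfl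
    (fun i p q => by rw [hν]; rfl) (hS.2 S.start) p q
  rw [hν] at h
  simp only [startExpr, den, h, hν, insertionCls]
  cases trackL <;> simp [monotoneExpr, monotoneCls, den, hν, letter]

theorem solution_eq (hS : S.IsAdmissible) (hν : den (solution S trackL ν) N = ν)
    (i : Idx S.Idx) : solution S trackL ν i =
      single Trace.unfold * den (solution S trackL ν) (equation S trackL N i) * single 1 := by
  rw [← one_eq, mul_one]
  cases i with
  | run i p q =>
    rw [equation, den_expr (S := S) rfl (fun i p q => by rw [hν]; rfl) (hS.2 i), hν, solution,
      objCls_cls, ← one_eq, mul_one, map_mul, lift_single, run_unfold, Matrix.diagonal_mul]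
  | bot => exact (mul_zero _).symm
  | nat =>
    change natCls = _ * (1 + letter .Z * natCls)
    rw [natCls]
    conv_lhs => rw [star_eq]
    rw [mul_assoc (letter .Z)]
  | start => rw [equation, den_startExpr hS hν, solution]

theorem seqMin_startExpr (hS : S.IsAdmissible) (hν : den (solution S trackL ν) N = ν)
    (hN : SeqMin (solution S trackL ν) N) :
    SeqMin (solution S trackL ν) (startExpr trackL N (S.eqn S.start)) := by
  have h := fun p q => seqMin_expr (S := S) (N := N) (Y := solution S trackL ν) rfl
    (fun i p q => by rw [hν]; rfl) hN (hS.2 S.start) p q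
  cases trackL <;> simp [startExpr, monotoneExpr, SeqMin, hN, h]

theorem seqMin_equation (hS : S.IsAdmissible) (hν : den (solution S trackL ν) N = ν)
    (hN : SeqMin (solution S trackL ν) N) (i : Idx S.Idx) :
    SeqMin (solution S trackL ν) (equation S trackL N i) := by
  cases i with
  | run i p q => exact seqMin_expr rfl (fun i p q => by rw [hν]; rfl) hN (hS.2 i) p q
  | bot => trivial
  | nat => exact ⟨trivial, trivial, trivial⟩
  | start => exact seqMin_startExpr hS hν hN

theorem isFin_insertionCls (hν : IsFin ν) {x : Cls Trace} (hx : IsFin x) :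
    IsFin (insertionCls trackL ν x) := by
  have hl : ∀ a, IsFin (letter a) := fun a => isFin_single _
  refine isFin_one.add (IsFin.add ?_
    (((isFin_lift_run hν hx 0 1).mul (hν.mul (hl _))).add (isFin_lift_run hν hx 0 2)))
  rw [monotoneCls]
  split_ifs
  · exact (hl _).add ((hl _).mul (hν.mul (hl _)))
  · exact hν.mul (hl _)

theorem isFin_natCls : IsFin natCls := by
  rw [natCls, letter, ← single_mul]
  exact (isFin_single _).mul (isFin_star_single (by simp))

theorem isFin_solution (hS : S.IsAdmissible) (hν : IsFin ν) (i : Idx S.Idx) :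
    IsFin (solution S trackL ν i) := by
  have h := ((isAdmissible_iff (u := Trace.unfold) (v := 1) (by simp) (by simp)).1 hS).1
  cases i with
  | run i p q => exact isFin_lift_run hν (h i) p q
  | bot => exact isFin_zero
  | nat => exact isFin_natCls
  | start =>
    exact (isFin_single _).mul (isFin_insertionCls hν
      (isFin_objCls_eqn (by simp) (by simp) _ (h S.start)))

end

theorem map_erase_run (ν : Cls Trace) (m : Trace) (p q : Fin 3) :
    map Trace.erase (run ν m p q) = run (map Trace.erase ν) (Trace.erase m) p q := by
  have hl : ∀ a, map Trace.erase (letter a) = letter a := fun a => by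
    rw [letter, map_single, Trace.erase_atom]
  induction m using Trace.induction generalizing p q with
  | h1 => simp only [map_one, Matrix.one_apply]; split_ifs <;> simp
  | hu m ih =>
    rw [map_mul, run_unfold, Matrix.diagonal_mul, map_mul, ih, map_single, map_mul,
      Trace.erase_unfold, one_mul, ← one_eq, one_mul]
  | ha a m ih =>
    rw [map_mul, map_mul, map_mul, Trace.erase_atom, run_atom, run_atom, Matrix.mul_apply,
      Matrix.mul_apply, map_sum]
    refine Finset.sum_congr rfl fun r _ => ?_
    rw [map_mul, ih]
    congr 1
    fin_cases p <;> fin_cases r <;> simp [step, hl]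
    split_ifs <;> simp [hl]

theorem map_erase_insertionCls (trackL : Bool) (ν x : Cls Trace) :
    map Trace.erase (insertionCls trackL ν x) =
      insertionCls trackL (map Trace.erase ν) (map Trace.erase x) := by
  have hl : ∀ a, map Trace.erase (letter a) = letter a := fun a => by
    rw [letter, map_single, Trace.erase_atom]
  have h := map_lift (run ν) (run (map Trace.erase ν)) Trace.erase Trace.erase
    (map_erase_run ν) x
  simp only [insertionCls, map_add, map_mul, map_one, h, hl]
  cases trackL <;> simp [monotoneCls, hl]

theorem map_erase_natCls : map Trace.erase natCls = star (letter .Z) := by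
  rw [natCls, map_mul, Cls.map_star, map_mul, letter, map_single, map_single, Trace.erase_unfold,
    Trace.erase_atom, ← one_eq, one_mul, mul_one]

/-! ### Specifications of the three sorts -/

theorem seqFree_expr {N : Constructor (Idx ι)} (hN : N.SeqFree) {A : Constructor ι}
    (hA : A.SeqFree) (p q : Fin 3) : (expr N A p q).SeqFree := by
  induction A generalizing p q with
  | neutral => rw [expr, Matrix.of_apply]; split_ifs <;> trivial
  | atom a =>
    fin_cases p <;> fin_cases q <;> simp [expr, stepExpr, Constructor.SeqFree, hN]
    split_ifs <;> trivial
  | cls i => trivial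
  | sum A B ihA ihB => exact ⟨ihA hA.1 p q, ihB hA.2 p q⟩
  | prod A B ihA ihB =>
    exact ⟨⟨⟨ihA hA.1 _ _, ihB hA.2 _ _⟩, ⟨ihA hA.1 _ _, ihB hA.2 _ _⟩⟩,
      ⟨ihA hA.1 _ _, ihB hA.2 _ _⟩⟩
  | seq A ih => exact hA.elim

theorem isContextFree_spec {S : Specification} (hS : S.IsContextFree) (trackL : Bool) :
    (spec S trackL (.cls .nat)).IsContextFree := by
  have h := fun i => seqFree_expr (N := .cls .nat) trivial (hS i)
  intro i
  change (equation S trackL (.cls .nat) i).SeqFree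
  cases i with
  | run i p q => exact h i p q
  | bot => trivial
  | nat => exact ⟨trivial, trivial, trivial⟩
  | start =>
    cases trackL <;> simp [equation, startExpr, monotoneExpr, Constructor.SeqFree, h]

/-- The only class symbol in the expression is the one of the empty class. -/
def OnlyBot : Constructor (Idx ι) → Prop
  | .neutral => True
  | .atom _ => True
  | .cls i => i = .bot
  | .sum A B => OnlyBot A ∧ OnlyBot B
  | .prod A B => OnlyBot A ∧ OnlyBot B
  | .seq A => OnlyBot A

theorem onlyBot_expr {N : Constructor (Idx ι)} (hN : OnlyBot N) {A : Constructor ι}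
    (hA : A.ClassFree) (p q : Fin 3) : OnlyBot (expr N A p q) := by
  induction A generalizing p q with
  | neutral => rw [expr, Matrix.of_apply]; split_ifs <;> trivial
  | atom a =>
    fin_cases p <;> fin_cases q <;> simp [expr, stepExpr, OnlyBot, hN]
    split_ifs <;> trivial
  | cls i => exact hA.elim
  | sum A B ihA ihB => exact ⟨ihA hA.1 p q, ihB hA.2 p q⟩
  | prod A B ihA ihB =>
    exact ⟨⟨⟨ihA hA.1 _ _, ihB hA.2 _ _⟩, ⟨ihA hA.1 _ _, ihB hA.2 _ _⟩⟩,
      ⟨ihA hA.1 _ _, ihB hA.2 _ _⟩⟩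
  | seq A ih => fin_cases p <;> fin_cases q <;> simp [expr, starExpr, OnlyBot, ih hA]

/-- The empty class can be eliminated from an expression, unless the whole expression denotes the
empty class. -/
theorem exists_classFree {Y : Idx ι → Cls Trace} (hbot : Y .bot = 0) {A : Constructor (Idx ι)}
    (hA : OnlyBot A) (hseq : SeqMin Y A) :
    den Y A = 0 ∨ ∃ B : Constructor (Idx ι), B.ClassFree ∧ SeqMin Y B ∧ den Y B = den Y A := by
  induction A with
  | neutral => exact .inr ⟨.neutral, trivial, trivial, rfl⟩
  | atom a => exact .inr ⟨.atom a, trivial, trivial, rfl⟩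
  | cls i => exact .inl (by rw [den, show i = .bot from hA, hbot])
  | sum A B ihA ihB =>
    rcases ihA hA.1 hseq.1 with h | ⟨A', hA1, hA2, hA3⟩ <;>
      rcases ihB hA.2 hseq.2 with h' | ⟨B', hB1, hB2, hB3⟩
    · exact .inl (by rw [den, h, h', add_zero])
    · exact .inr ⟨B', hB1, hB2, by rw [den, h, hB3, zero_add]⟩
    · exact .inr ⟨A', hA1, hA2, by rw [den, h', hA3, add_zero]⟩
    · exact .inr ⟨.sum A' B', ⟨hA1, hB1⟩, ⟨hA2, hB2⟩, by rw [den, den, hA3, hB3]⟩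
  | prod A B ihA ihB =>
    rcases ihA hA.1 hseq.1 with h | ⟨A', hA1, hA2, hA3⟩
    · exact .inl (by rw [den, h, zero_mul])
    rcases ihB hA.2 hseq.2 with h' | ⟨B', hB1, hB2, hB3⟩
    · exact .inl (by rw [den, h', mul_zero])
    · exact .inr ⟨.prod A' B', ⟨hA1, hB1⟩, ⟨hA2, hB2⟩, by rw [den, den, hA3, hB3]⟩
  | seq A ih =>
    rcases ih hA hseq.1 with h | ⟨A', hA1, hA2, hA3⟩
    · refine .inr ⟨.neutral, trivial, trivial, ?_⟩
      rw [den, den, h, star_eq, zero_mul, add_zero]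
    · exact .inr ⟨.seq A', hA1, ⟨hA2, hA3 ▸ hseq.2⟩, by rw [den, den, hA3]⟩

theorem insertionCls_ne_zero (trackL : Bool) (ν x : Cls Trace) : insertionCls trackL ν x ≠ 0 := by
  rw [insertionCls]
  generalize monotoneCls trackL ν + _ = y
  obtain ⟨Y, w, rfl⟩ := exists_mk y
  intro h
  exact (isEmpty_of_mk_eq_zero (X := Unit ⊕ Y) h).false (.inl ())

theorem wordCls_start_eq (S : Specification) :
    map Trace.erase (objCls S Trace.unfold 1 (S.eqn S.start)) = wordCls S (.cls S.start) := by
  rw [← map_erase_objCls Trace.erase_unfold (map_one _) (.cls S.start), objCls_cls, map_mul,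
    map_mul, map_single, map_single, Trace.erase_unfold, map_one, ← one_eq, one_mul, mul_one]

/-- The insertion of an increasing sequence has a specification, of the same sort as the given
one. -/
theorem exists_specification {S : Specification} (hS : S.IsAdmissible) {K : Kind}
    (hK : S.HasKind K) (trackL : Bool) :
    ∃ S' : Specification, S'.HasKind K ∧ S'.IsAdmissible ∧ wordCls S' (.cls S'.start) =
      insertionCls trackL (star (letter .Z)) (wordCls S (.cls S.start)) := by
  have hstart : ∀ ν, map Trace.erase ν = star (letter .Z) →
      map Trace.erase (solution S trackL ν .start) =
        insertionCls trackL (star (letter .Z)) (wordCls S (.cls S.start)) := fun ν hν => by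
    rw [solution, map_mul, map_single, Trace.erase_unfold, ← one_eq, one_mul,
      map_erase_insertionCls, hν, wordCls_start_eq]
  by_cases hreg : S.IsRegular ∧ K = .regular
  · -- All equations of the new system get the same right-hand side, without class symbols.
    obtain ⟨hreg, rfl⟩ := hreg
    let Y := solution S trackL (star (letter .Z))
    have hν : den Y (.seq (.atom .Z)) = star (letter .Z) := rfl
    have hN : SeqMin Y (.seq (.atom .Z)) := ⟨trivial, minSize_single (by simp)⟩
    have hmapν : map Trace.erase (star (letter .Z)) = star (letter .Z) := by
      rw [Cls.map_star, letter, map_single, Trace.erase_atom]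
    have hden := den_startExpr hS hν
    have honly : OnlyBot (startExpr trackL (.seq (.atom .Z)) (S.eqn S.start)) := by
      have h := onlyBot_expr (N := .seq (.atom .Z)) trivial (hreg S.start)
      cases trackL <;> simp [startExpr, monotoneExpr, OnlyBot, h]
    rcases exists_classFree (Y := Y) rfl honly (seqMin_startExpr hS hν hN) with h | ⟨B, hB, hB2, hB3⟩
    · exact (insertionCls_ne_zero _ _ _ (hden.symm.trans h)).elim
    · let S' : Specification :=
        { Idx := Idx S.Idx
          finite_idx := haveI := S.finite_idx; inferInstance
          start := .start
          eqn := fun _ => B }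
      have hsol : ∀ _ : S'.Idx, Y .start =
          single Trace.unfold * den (fun _ : S'.Idx => Y .start) B * single 1 := fun _ => by
        rw [← (den_congr_of_classFree Y hB _).1, hB3, hden, ← one_eq, mul_one]
        rfl
      obtain ⟨h1, h2⟩ := admissible_and_wordCls_of_solution (S := S') (u := Trace.unfold) (v := 1)
        (by simp) (by simp) (by simp) (by simp) (by simp) hsol
        (fun _ => isFin_solution hS (isFin_star_single (by simp)) .start)
        (fun _ => (den_congr_of_classFree Y hB _).2 hB2)
      exact ⟨S', fun _ => hB, h1, (h2 S'.start).trans (hstart _ hmapν)⟩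
  · have hν : den (solution S trackL natCls) (.cls .nat) = natCls := rfl
    obtain ⟨h1, h2⟩ := admissible_and_wordCls_of_solution
      (S := spec S trackL (.cls .nat)) (u := Trace.unfold) (v := 1)
      (by simp) (by simp) (by simp) (by simp) (by simp) (solution_eq hS hν)
      (isFin_solution hS isFin_natCls) (seqMin_equation hS hν trivial)
    refine ⟨spec S trackL (.cls .nat), ?_, h1, (h2 Idx.start).trans (hstart _ map_erase_natCls)⟩
    cases K with
    | arbitrary => trivial
    | contextFree => exact isContextFree_spec hK trackL
    | regular => exact (hreg ⟨hK, rfl⟩).elim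

end Insertion

/-! ### Relabelling and reversing specifications -/

namespace Trace

/-- Replace the atoms in a trace. -/
def relabel (f : Atom → Atom) : Trace →* Trace := FreeMonoid.map (Option.map f)

theorem size_relabel (f : Atom → Atom) (m : Trace) :
    (relabel f m).size = m.size := by
  simp [Trace.size, relabel, FreeMonoid.toList_map, List.countP_map, Function.comp_def]

theorem relabel_ofWord (f : Atom → Atom) (w : List Atom) :
    relabel f (ofWord w) = ofWord (w.map f) := by
  induction w with
  | nil => rfl
  | cons a w ih => rw [ofWord_cons, map_mul, ih]; rfl

theorem erase_relabel (f : Atom → Atom) (m : Trace) :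
    erase (relabel f m) = relabel f (erase m) := by
  induction m using induction with
  | h1 => simp
  | hu m ih => rw [map_mul, map_mul, map_mul, map_mul, ih]; rfl
  | ha a m ih => rw [map_mul, map_mul, map_mul, map_mul, ih]; rfl

/-- The trace read from right to left. -/
def reverse (m : Trace) : Trace := FreeMonoid.ofList (FreeMonoid.toList m).reverse

theorem reverse_mul (m m' : Trace) : reverse (m * m') = reverse m' * reverse m := by
  simp [reverse, FreeMonoid.toList_mul, FreeMonoid.ofList_append]

theorem size_reverse (m : Trace) : size (reverse m) = m.size := by
  simp [size, reverse]

theorem reverse_ofWord (w : List Atom) :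
    reverse (ofWord w) = ofWord w.reverse := by
  simp [reverse, ofWord, List.map_reverse]

theorem erase_reverse (m : Trace) :
    erase (reverse m) = reverse (erase m) := by
  induction m using induction with
  | h1 => rfl
  | hu m ih =>
    rw [reverse_mul, map_mul, map_mul, ih, reverse_mul]; rfl
  | ha a m ih =>
    rw [reverse_mul, map_mul, map_mul, ih, reverse_mul]; rfl

end Trace

namespace Cls

theorem minSize_map_relabel {k : ℕ} {x : Cls Trace} (f : Atom → Atom)
    (h : MinSize k x) : MinSize k (map (Trace.relabel f) x) := by
  obtain ⟨X, w, rfl⟩ := exists_mk x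
  exact all_mk.2 fun a => (all_mk.1 h a).trans_eq (Trace.size_relabel f _).symm

theorem isFin_map_relabel {x : Cls Trace} (f : Atom → Atom) (h : IsFin x) :
    IsFin (map (Trace.relabel f) x) := by
  obtain ⟨X, w, rfl⟩ := exists_mk x
  refine isFin_mk.2 fun n => ?_
  simpa only [Trace.size_relabel] using isFin_mk.1 h n

/-- Reverse all weights of a class. -/
noncomputable def reverse : Cls Trace → Cls Trace :=
  Quotient.map (fun X => ⟨X.carrier, fun a => Trace.reverse (X.wt a)⟩) (by
    rintro X X' ⟨e, h⟩
    exact ⟨e, fun x => by simp [h]⟩)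

theorem reverse_mk {X : Type} (w : X → Trace) :
    reverse (mk w) = mk fun a => Trace.reverse (w a) := rfl

theorem reverse_add (x y : Cls Trace) :
    reverse (x + y) = reverse x + reverse y := by
  obtain ⟨X, u, rfl⟩ := exists_mk x
  obtain ⟨Y, v, rfl⟩ := exists_mk y
  refine mk_congr (Equiv.refl (X ⊕ Y)) ?_
  rintro (x | x) <;> rfl

theorem reverse_mul (x y : Cls Trace) :
    reverse (x * y) = reverse y * reverse x := by
  obtain ⟨X, u, rfl⟩ := exists_mk x
  obtain ⟨Y, v, rfl⟩ := exists_mk y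
  exact mk_congr (Equiv.prodComm X Y) fun p => (Trace.reverse_mul (u p.1) (v p.2)).symm

theorem reverse_star (x : Cls Trace) :
    reverse (star x) = star (reverse x) := by
  obtain ⟨X, u, rfl⟩ := exists_mk x
  refine mk_congr_of_bijective (X := List X) List.reverse List.reverse_involutive.bijective
    fun l => ?_
  induction l with
  | nil => rfl
  | cons a l ih => simpa [Trace.reverse_mul] using ih

theorem minSize_reverse {k : ℕ} {x : Cls Trace} (h : MinSize k x) :
    MinSize k (reverse x) := by
  obtain ⟨X, w, rfl⟩ := exists_mk x
  exact all_mk.2 fun a => (all_mk.1 h a).trans_eq (Trace.size_reverse _).symm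

theorem isFin_reverse {x : Cls Trace} (h : IsFin x) : IsFin (reverse x) := by
  obtain ⟨X, w, rfl⟩ := exists_mk x
  refine isFin_mk.2 fun n => ?_
  simpa only [Trace.size_reverse] using isFin_mk.1 h n

end Cls

namespace Specification

open Cls

/-- Replace the atoms in an expression. -/
def relabelExpr {ι : Type} (f : Atom → Atom) : Constructor ι → Constructor ι
  | .neutral => .neutral
  | .atom a => .atom (f a)
  | .cls i => .cls i
  | .sum A B => .sum (relabelExpr f A) (relabelExpr f B)
  | .prod A B => .prod (relabelExpr f A) (relabelExpr f B)
  | .seq A => .seq (relabelExpr f A)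

/-- Reverse the order of the factors in all products. -/
def reverseExpr {ι : Type} : Constructor ι → Constructor ι
  | .neutral => .neutral
  | .atom a => .atom a
  | .cls i => .cls i
  | .sum A B => .sum (reverseExpr A) (reverseExpr B)
  | .prod A B => .prod (reverseExpr B) (reverseExpr A)
  | .seq A => .seq (reverseExpr A)

/-- Replace the atoms in a specification. -/
def relabel (S : Specification) (f : Atom → Atom) : Specification :=
  { S with eqn := fun i => relabelExpr f (S.eqn i) }

/-- Reverse the order of the factors in all products of a specification. -/
def reverse (S : Specification) : Specification :=
  { S with eqn := fun i => reverseExpr (S.eqn i) }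

theorem hasKind_of_eqn {S : Specification} {K : Kind} (hK : S.HasKind K)
    (g : Constructor S.Idx → Constructor S.Idx) (h1 : ∀ A, A.SeqFree → (g A).SeqFree)
    (h2 : ∀ A, A.ClassFree → (g A).ClassFree) :
    ({ S with eqn := fun i => g (S.eqn i) } : Specification).HasKind K := by
  cases K with
  | arbitrary => trivial
  | contextFree => exact fun i => h1 _ (hK i)
  | regular => exact fun i => h2 _ (hK i)

theorem hasKind_relabel {S : Specification} {K : Kind} (hK : S.HasKind K) (f : Atom → Atom) :
    (S.relabel f).HasKind K := by
  refine hasKind_of_eqn hK _ (fun A hA => ?_) fun A hA => ?_ <;> induction A <;>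
    simp_all [relabelExpr, Constructor.SeqFree, Constructor.ClassFree]

theorem hasKind_reverse {S : Specification} {K : Kind} (hK : S.HasKind K) :
    S.reverse.HasKind K := by
  refine hasKind_of_eqn hK _ (fun A hA => ?_) fun A hA => ?_ <;> induction A <;>
    simp_all [reverseExpr, Constructor.SeqFree, Constructor.ClassFree]

/-- The relabelled specification has the same objects, with relabelled words. -/
theorem relabel_correct {S : Specification} (hS : S.IsAdmissible) (f : Atom → Atom) :
    (S.relabel f).IsAdmissible ∧ wordCls (S.relabel f) (.cls (S.relabel f).start) =
      Cls.mk fun d : Obj S (.cls S.start) => Trace.ofWord (d.word.map f) := by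
  let Y : S.Idx → Cls Trace := fun i =>
    map (Trace.relabel f) (objCls S Trace.unfold 1 (.cls i))
  have hden : ∀ A, den Y (relabelExpr f A) = map (Trace.relabel f) (objCls S Trace.unfold 1 A) := by
    intro A
    rw [objCls_eq_den]
    induction A with
    | neutral => rw [den, map_one]; rfl
    | atom a => rfl
    | cls i => rfl
    | sum A B ihA ihB => rw [den, map_add, relabelExpr, den, ihA, ihB]
    | prod A B ihA ihB => rw [den, map_mul, relabelExpr, den, ihA, ihB]
    | seq A ih => rw [den, Cls.map_star, relabelExpr, den, ih]
  have hseq : ∀ A, SeqProper S A → SeqMin Y (relabelExpr f A) := by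
    intro A hA
    induction A with
    | neutral => trivial
    | atom a => trivial
    | cls i => trivial
    | sum A B ihA ihB => exact ⟨ihA hA.1, ihB hA.2⟩
    | prod A B ihA ihB => exact ⟨ihA hA.1, ihB hA.2⟩
    | seq A ih =>
      refine ⟨ih hA.1, ?_⟩
      rw [hden]
      exact minSize_map_relabel f ((minSize_objCls_iff (by simp) (by simp) A).2 hA.2)
  have hY : ∀ i, Y i = single Trace.unfold * den Y (relabelExpr f (S.eqn i)) * single 1 :=
    fun i => by
      rw [hden, ← one_eq, mul_one]
      simp only [Y]
      rw [objCls_cls, ← one_eq, mul_one, map_mul]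
      rfl
  obtain ⟨h1, h2⟩ := admissible_and_wordCls_of_solution (S := S.relabel f) (u := Trace.unfold)
    (v := 1) (Y := Y) (by simp) (by simp) (by simp) (by simp) (by simp)
    hY
    (fun i => isFin_map_relabel f
      (((isAdmissible_iff (u := Trace.unfold) (v := 1) (by simp) (by simp)).1 hS).1 i))
    (fun i => hseq _ (hS.2 i))
  refine ⟨h1, (h2 S.start).trans ?_⟩
  simp only [Y, objCls, map_mk, Trace.erase_relabel,
    Obj.erase_trace Trace.erase_unfold (map_one _), Trace.relabel_ofWord]

/-- The reversed specification has the same objects, with reversed words. -/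
theorem reverse_correct {S : Specification} (hS : S.IsAdmissible) :
    S.reverse.IsAdmissible ∧ wordCls S.reverse (.cls S.reverse.start) =
      Cls.mk fun d : Obj S (.cls S.start) => Trace.ofWord d.word.reverse := by
  let Y : S.Idx → Cls Trace := fun i => Cls.reverse (objCls S Trace.unfold 1 (.cls i))
  have hden : ∀ A, den Y (reverseExpr A) = Cls.reverse (objCls S Trace.unfold 1 A) := by
    intro A
    rw [objCls_eq_den]
    induction A with
    | neutral => rfl
    | atom a => rfl
    | cls i => rfl
    | sum A B ihA ihB => rw [den, Cls.reverse_add, reverseExpr, den, ihA, ihB]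
    | prod A B ihA ihB => rw [den, Cls.reverse_mul, reverseExpr, den, ihA, ihB]
    | seq A ih => rw [den, Cls.reverse_star, reverseExpr, den, ih]
  have hseq : ∀ A, SeqProper S A → SeqMin Y (reverseExpr A) := by
    intro A hA
    induction A with
    | neutral => trivial
    | atom a => trivial
    | cls i => trivial
    | sum A B ihA ihB => exact ⟨ihA hA.1, ihB hA.2⟩
    | prod A B ihA ihB => exact ⟨ihB hA.2, ihA hA.1⟩
    | seq A ih =>
      refine ⟨ih hA.1, ?_⟩
      rw [hden]
      exact minSize_reverse ((minSize_objCls_iff (by simp) (by simp) A).2 hA.2)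
  -- Reversal moves the marker of an unfolding behind the object.
  have hY : ∀ i, Y i = single 1 * den Y (reverseExpr (S.eqn i)) * single Trace.unfold :=
    fun i => by
      rw [hden, ← one_eq, one_mul]
      simp only [Y]
      rw [objCls_cls, ← one_eq, mul_one, Cls.reverse_mul]
      rfl
  obtain ⟨h1, h2⟩ := admissible_and_wordCls_of_solution (S := S.reverse) (u := 1)
    (v := Trace.unfold) (Y := Y) (by simp) (by simp) (by simp) (by simp) (by simp)
    hY
    (fun i => isFin_reverse
      (((isAdmissible_iff (u := Trace.unfold) (v := 1) (by simp) (by simp)).1 hS).1 i))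
    (fun i => hseq _ (hS.2 i))
  refine ⟨h1, (h2 S.start).trans ?_⟩
  simp only [Y, objCls, Cls.reverse_mk, map_mk, Trace.erase_reverse,
    Obj.erase_trace Trace.erase_unfold (map_one _), Trace.reverse_ofWord]

/-- The class of a set of permutations, weighted by their bottom-to-top readings. -/
def permCls (trackL trackR : Bool) (C : Set Permutation) : Cls Trace :=
  Cls.mk fun π : C => Trace.ofWord (Permutation.bottomToTop trackL trackR (π : Permutation))

theorem isBottomToTopFor_iff {S : Specification} {trackL trackR : Bool} {C : Set Permutation} :
    S.IsBottomToTopFor trackL trackR C ↔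
      S.IsAdmissible ∧ wordCls S (.cls S.start) = permCls trackL trackR C := by
  rw [IsBottomToTopFor, wordCls, permCls, mk_eq_mk]
  refine and_congr_right fun _ => exists_congr fun e => forall_congr' fun d => ?_
  rw [Trace.ofWord_injective.eq_iff, eq_comm]

end Specification

/-! ### Shuffles of a list with new entries -/

namespace Insertion

open Cls

variable {β : Type} (mark : β → Atom)

/-- The word of a list of entries, in which `none` stands for a new entry. The last new entry is the
rightmost entry of the result. -/
def shuffleWord : List (Option β) → Trace
  | [] => 1
  | none :: l => Trace.atom (if l.any Option.isNone then .Z else .ZR) *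
      shuffleWord l
  | some x :: l => Trace.atom (mark x).dropRight * shuffleWord l

/-- There is a new entry; no old entry before the first new one is marked as the rightmost entry,
and some old entry comes after it. If one old entry is marked, this means that a new entry comes
before the marked one. -/
def NewFirst : List (Option β) → Prop
  | [] => False
  | none :: l => l.reduceOption ≠ []
  | some x :: l => (mark x).isRight = false ∧ NewFirst l

/-- The class of the lists with the property `P`, weighted by `w`. -/
def listCls (P : List (Option β) → Prop) (w : List (Option β) → Trace) : Cls Trace :=
  mk fun l : {l // P l} => w l.1

variable {mark}

theorem listCls_congr {P P' : List (Option β) → Prop} {w w' : List (Option β) → Trace}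
    (h : ∀ l, P l ↔ P' l) (hw : ∀ l, P l → w l = w' l) : listCls P w = listCls P' w' :=
  mk_congr (Equiv.subtypeEquivRight h) fun l => (hw l.1 l.2).symm

theorem listCls_eq_zero {P : List (Option β) → Prop} {w : List (Option β) → Trace}
    (h : ∀ l, ¬ P l) : listCls P w = 0 :=
  eq_zero_of_isEmpty _ ⟨fun l => h l.1 l.2⟩

theorem listCls_mul (P : List (Option β) → Prop) (m : Trace) (w : List (Option β) → Trace) :
    listCls P (fun l => m * w l) = single m * listCls P w :=
  mk_congr (Equiv.punitProd _).symm fun _ => rfl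

theorem listCls_split (P Q : List (Option β) → Prop) (w : List (Option β) → Trace) :
    listCls P w = listCls (fun l => P l ∧ Q l) w + listCls (fun l => P l ∧ ¬ Q l) w := by
  refine (mk_congr_of_bijective (Sum.elim (fun l => ⟨l.1, l.2.1⟩) fun l => ⟨l.1, l.2.1⟩)
    ⟨?_, ?_⟩ ?_).symm
  · rintro (⟨l, h1, h2⟩ | ⟨l, h1, h2⟩) (⟨l', h3, h4⟩ | ⟨l', h3, h4⟩) h <;>
      obtain rfl : l = l' := congrArg Subtype.val h
    exacts [rfl, (h4 h2).elim, (h2 h4).elim, rfl]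
  · rintro ⟨l, h⟩
    by_cases hq : Q l
    · exact ⟨.inl ⟨l, h, hq⟩, rfl⟩
    · exact ⟨.inr ⟨l, h, hq⟩, rfl⟩
  · rintro (l | l) <;> rfl

theorem listCls_cons {P : List (Option β) → Prop} {w : List (Option β) → Trace} (x : β)
    (hnil : ¬ P []) (hx : ∀ y l, P (some y :: l) → y = x) :
    listCls P w = listCls (fun l => P (none :: l)) (fun l => w (none :: l)) +
      listCls (fun l => P (some x :: l)) fun l => w (some x :: l) := by
  refine (mk_congr_of_bijective (Sum.elim (fun l => ⟨none :: l.1, l.2⟩) fun l => ⟨some x :: l.1, l.2⟩)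
    ⟨?_, ?_⟩ ?_).symm
  · rintro (⟨l, h1⟩ | ⟨l, h1⟩) (⟨l', h3⟩ | ⟨l', h3⟩) h <;> simp_all
  · rintro ⟨_ | ⟨_ | y, l⟩, h⟩
    · exact (hnil h).elim
    · exact ⟨.inl ⟨l, h⟩, rfl⟩
    · obtain rfl := hx y l h
      exact ⟨.inr ⟨l, h⟩, rfl⟩
  · rintro (l | l) <;> rfl

theorem any_isNone_iff (l : List (Option β)) :
    l.any Option.isNone ↔ none ∈ l := by
  simp [Option.isNone_iff_eq_none]

variable (mark)

/-- The shuffles of `ls` with at least one new entry. -/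
def someNew (ls : List β) : Cls Trace :=
  listCls (fun l => l.reduceOption = ls ∧ none ∈ l) (shuffleWord mark)

/-- The shuffle of `ls` with no new entry. -/
def noNew (ls : List β) : Cls Trace :=
  listCls (fun l => l.reduceOption = ls ∧ none ∉ l) (shuffleWord mark)

/-- The shuffles of `ls` in which a new entry comes before the rightmost entry of `ls`. -/
def newFirst (ls : List β) : Cls Trace :=
  listCls (fun l => l.reduceOption = ls ∧ NewFirst mark l) (shuffleWord mark)

theorem listCls_new_cons (ls : List β) :
    listCls (fun l => l.reduceOption = ls) (fun l => shuffleWord mark (none :: l)) =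
      letter .Z * someNew mark ls + letter .ZR * noNew mark ls := by
  rw [listCls_split _ (fun l => none ∈ l), letter, letter, someNew, noNew, ← listCls_mul,
    ← listCls_mul]
  congr 1
  · exact listCls_congr (fun l => Iff.rfl) fun l hl => by
      rw [shuffleWord, if_pos ((any_isNone_iff l).2 hl.2)]
  · exact listCls_congr (fun l => Iff.rfl) fun l hl => by
      rw [shuffleWord, if_neg (fun h => hl.2 ((any_isNone_iff l).1 h))]

theorem noNew_nil : noNew mark [] = 1 := by
  refine mk_congr ⟨fun _ => (), fun _ => ⟨[], rfl, by simp⟩, ?_, fun _ => rfl⟩ ?_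
  · rintro ⟨_ | ⟨_ | x, l⟩, h1, h2⟩
    · rfl
    · simp at h2
    · simp at h1
  · rintro ⟨_ | ⟨_ | x, l⟩, h1, h2⟩
    · rfl
    · simp at h2
    · simp at h1

theorem noNew_cons (x : β) (ls : List β) :
    noNew mark (x :: ls) = letter (mark x).dropRight * noNew mark ls := by
  rw [noNew, listCls_cons x (by simp) (by simp +contextual), listCls_eq_zero (by simp), zero_add,
    letter, noNew, ← listCls_mul]
  exact listCls_congr (by simp) fun l _ => rfl

theorem someNew_nil : someNew mark [] = star (letter .Z) * letter .ZR := by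
  refine eq_star_mul (minSize_single (by simp)) ?_
  have h : someNew mark [] = listCls (fun l => l.reduceOption = [])
      (fun l => shuffleWord mark (none :: l)) := by
    refine (mk_congr_of_bijective (X := {l : List (Option β) // l.reduceOption = []})
      (Y := {l : List (Option β) // l.reduceOption = [] ∧ none ∈ l})
      (w := fun l => shuffleWord mark (none :: l.1)) (w' := fun l => shuffleWord mark l.1)
      (fun l => ⟨none :: l.1, by simp [l.2]⟩) ⟨?_, ?_⟩ fun _ => rfl).symm
    · rintro ⟨l, h1⟩ ⟨l', h2⟩ h
      simpa using h
    · rintro ⟨_ | ⟨_ | x, l⟩, h1, h2⟩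
      · simp at h2
      · exact ⟨⟨l, by simpa using h1⟩, rfl⟩
      · simp at h1
  conv_lhs => rw [h]
  rw [listCls_new_cons, noNew_nil, mul_one, add_comm]

theorem someNew_cons (x : β) (ls : List β) :
    someNew mark (x :: ls) = star (letter .Z) *
      (letter .ZR * (letter (mark x).dropRight * noNew mark ls) +
        letter (mark x).dropRight * someNew mark ls) := by
  refine eq_star_mul (minSize_single (by simp)) ?_
  conv_lhs => rw [someNew, listCls_cons x (by simp) (by simp +contextual)]
  have h1 : listCls (fun l => (none :: l).reduceOption = x :: ls ∧ none ∈ none :: l)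
      (fun l => shuffleWord mark (none :: l)) =
      letter .Z * someNew mark (x :: ls) + letter .ZR * noNew mark (x :: ls) := by
    rw [← listCls_new_cons]
    exact listCls_congr (by simp) fun l _ => rfl
  have h2 : listCls (fun l => (some x :: l).reduceOption = x :: ls ∧ none ∈ some x :: l)
      (fun l => shuffleWord mark (some x :: l)) =
      letter (mark x).dropRight * someNew mark ls := by
    rw [letter, someNew, ← listCls_mul]
    exact listCls_congr (by simp) fun l _ => rfl
  rw [h1, h2, noNew_cons]
  abel

theorem newFirst_nil : newFirst mark [] = 0 := by
  refine listCls_eq_zero ?_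
  rintro (_ | ⟨_ | x, l⟩) ⟨h1, h2⟩
  · exact h2
  · exact h2 (by simpa using h1)
  · simp at h1

theorem newFirst_cons (x : β) (ls : List β) :
    newFirst mark (x :: ls) = letter .Z * someNew mark (x :: ls) +
      letter .ZR * noNew mark (x :: ls) +
        (if (mark x).isRight then 0 else letter (mark x)) * newFirst mark ls := by
  rw [newFirst, listCls_cons x (by simp [NewFirst]) (by simp +contextual)]
  have h1 : listCls (fun l => (none :: l).reduceOption = x :: ls ∧ NewFirst mark (none :: l))
      (fun l => shuffleWord mark (none :: l)) =
      letter .Z * someNew mark (x :: ls) + letter .ZR * noNew mark (x :: ls) := by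
    rw [← listCls_new_cons]
    exact listCls_congr (by simp +contextual [NewFirst]) fun l _ => rfl
  rw [h1]
  congr 1
  split_ifs with hx
  · rw [zero_mul]
    exact listCls_eq_zero (by simp [NewFirst, hx])
  · have hx' : (mark x).dropRight = mark x := by
      revert hx; cases mark x <;> simp [Atom.isRight, Atom.dropRight]
    rw [letter, newFirst, ← listCls_mul]
    exact listCls_congr (by simp [NewFirst, hx]) fun l _ => by rw [shuffleWord, hx']

/-- The insertion produces exactly the shuffles in which a new entry comes before the rightmost
entry. -/
theorem run_eq_newFirst (ls : List β) :
    run (star (letter .Z)) (Trace.ofWord (ls.map mark)) 0 1 * (star (letter .Z) * letter .ZR) +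
      run (star (letter .Z)) (Trace.ofWord (ls.map mark)) 0 2 = newFirst mark ls := by
  have key : run (star (letter .Z)) (Trace.ofWord (ls.map mark)) 2 2 = noNew mark ls ∧
      run (star (letter .Z)) (Trace.ofWord (ls.map mark)) 1 1 *
        (star (letter .Z) * letter .ZR) +
        run (star (letter .Z)) (Trace.ofWord (ls.map mark)) 1 2 = someNew mark ls ∧
      run (star (letter .Z)) (Trace.ofWord (ls.map mark)) 0 1 *
        (star (letter .Z) * letter .ZR) +
        run (star (letter .Z)) (Trace.ofWord (ls.map mark)) 0 2 = newFirst mark ls := by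
    induction ls with
    | nil => simp [noNew_nil, someNew_nil, newFirst_nil]
    | cons x ls ih =>
      obtain ⟨ih2, ih1, ih0⟩ := ih
      have h21 := run_blockTriangular (star (letter .Z)) (Trace.ofWord (ls.map mark))
        (i := 2) (j := 1) (by decide)
      rw [newFirst_cons, someNew_cons, noNew_cons, ← ih0, ← ih1, ← ih2]
      simp only [List.map_cons, Trace.ofWord_cons, map_mul, run_atom, Matrix.mul_apply,
        Fin.sum_univ_three, h21, step, Matrix.of_apply, Matrix.cons_val',
        Matrix.cons_val_zero, Matrix.cons_val_one, Matrix.cons_val, zero_mul, mul_zero, zero_add,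
        add_zero]
      generalize (if (mark x).isRight then (0 : Cls Trace) else letter (mark x)) = y
      refine ⟨trivial, ?_, ?_⟩
      · simp only [mul_add, mul_assoc]
        abel
      · have hs : ∀ z, star (letter .Z) * z = z + letter .Z * (star (letter .Z) * z) := fun z => by
          conv_lhs => rw [star_eq, add_mul, one_mul, mul_assoc]
        have hz := hs (letter .ZR * (letter (mark x).dropRight *
          run (star (letter .Z)) (Trace.ofWord (ls.map mark)) 2 2))
        simp only [mul_add, add_mul, mul_assoc]
        conv_lhs => rw [hz]
        abel
  exact key.2.2

end Insertion

/-! ### Permutations as lists of positions -/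

namespace Permutation

/-- The positions of a permutation in the order of the values of its entries, from bottom to top. -/
def positions (π : Permutation) : List ℕ := List.ofFn fun v => (π.2.symm v : ℕ)

/-- The value of the entry at a position; positions beyond the end keep their number, so that
distinct positions always have distinct values. -/
def value (π : Permutation) (x : ℕ) : ℕ := if h : x < π.1 then π.2 ⟨x, h⟩ else x

theorem value_fin (π : Permutation) (i : Fin π.1) : π.value i = π.2 i := by
  simp [value]

theorem value_of_lt (π : Permutation) {x : ℕ} (h : x < π.1) : π.value x = π.2 ⟨x, h⟩ := by
  simp [value, h]

theorem value_injective (π : Permutation) : Function.Injective π.value := by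
  intro x y h
  by_cases hx : x < π.1 <;> by_cases hy : y < π.1 <;> simp only [value, hx, hy, dite_true,
    dite_false] at h
  · simpa using π.2.injective (Fin.ext h)
  · have := (π.2 ⟨x, hx⟩).2; omega
  · have := (π.2 ⟨y, hy⟩).2; omega
  · exact h

@[simp] theorem length_positions (π : Permutation) : π.positions.length = π.1 := by
  simp [positions]

theorem mem_positions {π : Permutation} {x : ℕ} : x ∈ π.positions ↔ x < π.1 := by
  simp only [positions, List.mem_ofFn]
  constructor
  · rintro ⟨v, rfl⟩; exact (π.2.symm v).2
  · intro h; exact ⟨π.2 ⟨x, h⟩, by simp⟩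

theorem nodup_positions (π : Permutation) : π.positions.Nodup :=
  List.nodup_ofFn.2 fun _ _ h => π.2.symm.injective (Fin.ext h)

theorem pairwise_positions (π : Permutation) :
    π.positions.Pairwise fun x y => π.value x < π.value y := by
  rw [positions, List.pairwise_ofFn]
  intro v w h
  simpa [value_fin] using h

theorem positions_injective : Function.Injective positions := by
  rintro ⟨n, σ⟩ ⟨m, τ⟩ h
  obtain rfl : n = m := by simpa using congrArg List.length h
  have h' := List.ofFn_injective h
  have : σ.symm = τ.symm := Equiv.ext fun v => Fin.ext (congrFun h' v)
  rw [← σ.symm_symm, this, τ.symm_symm]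

theorem exists_positions_eq {L : List ℕ} (h1 : L.Nodup) (h2 : ∀ x ∈ L, x < L.length) :
    ∃ π : Permutation, π.positions = L := by
  let f : Fin L.length → Fin L.length := fun v => ⟨L[v], h2 _ (List.getElem_mem _)⟩
  have hf : Function.Injective f := fun v w h => by
    have := (h1.getElem_inj_iff (hi := v.2) (hj := w.2)).1 (congrArg Fin.val h)
    exact Fin.ext this
  refine ⟨⟨L.length, (Equiv.ofBijective f (Finite.injective_iff_bijective.1 hf)).symm⟩, ?_⟩
  simp [positions, f]

theorem bottomToTop_eq (trackL trackR : Bool) (π : Permutation) :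
    bottomToTop trackL trackR π = π.positions.map fun x =>
      Atom.ofMarks (trackL && decide (x = 0)) (trackR && decide (x + 1 = π.1)) := by
  rw [positions, List.map_ofFn]
  rfl

/-- A list of positions that is sorted by value is found inside the list of all positions. -/
theorem filter_positions_eq {π : Permutation} {K : List ℕ} {p : ℕ → Bool}
    (hp : ∀ x, x ∈ K ↔ x < π.1 ∧ p x) (hK : K.Pairwise fun x y => π.value x < π.value y) :
    π.positions.filter p = K := by
  have hn : K.Nodup := hK.imp fun h => by rintro rfl; exact lt_irrefl _ h
  refine List.Perm.eq_of_pairwise (le := fun x y => π.value x < π.value y)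
    (fun a b _ _ h h' => (lt_asymm h h').elim) (π.pairwise_positions.filter p) hK ?_
  rw [List.perm_ext_iff_of_nodup (π.nodup_positions.filter p) hn]
  intro x
  rw [List.mem_filter, mem_positions, hp]

theorem pairwise_of_sublist {π : Permutation} {K : List ℕ} (h : List.Sublist K π.positions) :
    K.Pairwise fun x y => π.value x < π.value y := π.pairwise_positions.sublist h

theorem pair_sublist_iff {π : Permutation} {x y : ℕ} (hx : x < π.1) (hy : y < π.1) :
    List.Sublist [x, y] π.positions ↔ π.value x < π.value y := by
  refine ⟨fun h => by simpa using pairwise_of_sublist h, fun h => ?_⟩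
  rw [← filter_positions_eq (π := π) (K := [x, y]) (p := fun z => z = x ∨ z = y) ?_ (by simpa)]
  · exact List.filter_sublist
  · intro z
    simp only [List.mem_cons, List.not_mem_nil, or_false, decide_eq_true_eq]
    constructor
    · rintro (rfl | rfl) <;> simp [*]
    · exact fun h => h.2

/-- The entries of `π` at the first `|σ|` positions are in the same relative order as those of
`σ`. -/
def IsPrefix (σ π : Permutation) : Prop :=
  σ.1 ≤ π.1 ∧ ∀ x < σ.1, ∀ y < σ.1, σ.value x < σ.value y ↔ π.value x < π.value y

/-- The entries from position `n` on are increasing. -/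
def IncreasingFrom (π : Permutation) (n : ℕ) : Prop :=
  ∀ x y, n ≤ x → x < y → y < π.1 → π.value x < π.value y

theorem isPrefix_iff {σ π : Permutation} (h : σ.1 ≤ π.1) :
    IsPrefix σ π ↔ π.positions.filter (· < σ.1) = σ.positions := by
  constructor
  · rintro ⟨-, h2⟩
    refine filter_positions_eq ?_ ?_
    · intro x
      simp only [mem_positions, decide_eq_true_eq]
      omega
    · refine σ.pairwise_positions.imp_of_mem ?_
      intro x y hx hy hxy
      exact (h2 x (mem_positions.1 hx) y (mem_positions.1 hy)).1 hxy
  · intro h'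
    have hp : σ.positions.Pairwise fun x y => π.value x < π.value y :=
      pairwise_of_sublist (h' ▸ List.filter_sublist)
    have key : ∀ x < σ.1, ∀ y < σ.1, σ.value x < σ.value y → π.value x < π.value y := by
      intro x hx y hy hxy
      have := hp.sublist ((pair_sublist_iff hx hy).2 hxy)
      simpa using this
    refine ⟨h, fun x hx y hy => ⟨key x hx y hy, fun hlt => ?_⟩⟩
    by_contra hge
    rcases (not_lt.1 hge).lt_or_eq with h1 | h1
    · exact lt_asymm hlt (key y hy x hx h1)
    · rw [σ.value_injective h1] at hlt
      exact lt_irrefl _ hlt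

theorem increasingFrom_iff {π : Permutation} {n m : ℕ} (h : π.1 = n + m) :
    π.IncreasingFrom n ↔ π.positions.filter (n ≤ ·) = List.range' n m := by
  constructor
  · intro h'
    refine filter_positions_eq ?_ ?_
    · intro x
      simp only [List.mem_range'_1, decide_eq_true_eq]
      omega
    · refine (List.pairwise_lt_range' (s := n) (n := m)).imp_of_mem ?_
      intro x y hx hy hxy
      simp only [List.mem_range'_1] at hx hy
      exact h' x y (by omega) hxy (by omega)
  · intro h' x y hx hxy hy
    have hp : (List.range' n m).Pairwise fun x y => π.value x < π.value y :=
      pairwise_of_sublist (h' ▸ List.filter_sublist)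
    have := hp.rel_get_of_lt (a := ⟨x - n, by simp; omega⟩) (b := ⟨y - n, by simp; omega⟩)
      (by simp only [Fin.mk_lt_mk]; omega)
    simp only [List.get_eq_getElem, List.getElem_range'_1] at this
    rwa [show n + (x - n) = x by omega, show n + (y - n) = y by omega] at this

theorem exists_isPrefix (π : Permutation) {n : ℕ} (hn : n ≤ π.1) :
    ∃ σ : Permutation, σ.1 = n ∧ IsPrefix σ π := by
  have hperm : (π.positions.filter (· < n)).Perm (List.range n) := by
    rw [List.perm_ext_iff_of_nodup (π.nodup_positions.filter _) List.nodup_range]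
    intro x
    simp only [List.mem_filter, mem_positions, decide_eq_true_eq, List.mem_range]
    omega
  have hlen : (π.positions.filter (· < n)).length = n := by simpa using hperm.length_eq
  obtain ⟨σ, hσ⟩ := exists_positions_eq (L := π.positions.filter (· < n))
    (π.nodup_positions.filter _) (fun x hx => by rw [hlen]; simpa using (List.mem_filter.1 hx).2)
  have hσn : σ.1 = n := by rw [← length_positions, hσ, hlen]
  exact ⟨σ, hσn, (isPrefix_iff (hσn ▸ hn)).2 (by rw [hσ, hσn])⟩

theorem IsPrefix.eq {σ τ π : Permutation} (hσ : IsPrefix σ π) (hτ : IsPrefix τ π)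
    (h : σ.1 = τ.1) : σ = τ := by
  refine positions_injective ?_
  rw [← (isPrefix_iff hσ.1).1 hσ, ← (isPrefix_iff hτ.1).1 hτ, h]

theorem IsPrefix.contained {σ τ π : Permutation} (hσ : IsPrefix σ π) (hτ : IsPrefix τ π)
    (h : σ.1 ≤ τ.1) : Contained σ τ := by
  refine ⟨Fin.castLEOrderEmb h, fun i j => ?_⟩
  have h1 := hσ.2 i i.2 j j.2
  have h2 := hτ.2 i (i.2.trans_le h) j (j.2.trans_le h)
  have h3 := h1.trans h2.symm
  rw [value_fin, value_fin, value_of_lt τ (i.2.trans_le h), value_of_lt τ (j.2.trans_le h)] at h3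
  exact h3

/-! ### Juxtapositions with an increasing sequence -/

theorem mem_av_p21_iff {τ : Permutation} : τ ∈ Av {p21} ↔ τ.IncreasingFrom 0 := by
  constructor
  · intro h x y _ hxy hy
    have hx : x < τ.1 := hxy.trans hy
    rw [value_of_lt τ hx, value_of_lt τ hy, Fin.val_fin_lt]
    by_contra hlt
    have hgt : τ.2 ⟨y, hy⟩ < τ.2 ⟨x, hx⟩ := by
      refine lt_of_le_of_ne (not_lt.1 hlt) fun h' => ?_
      have := τ.2.injective h'
      simp at this
      omega
    have hmono : StrictMono (![⟨x, hx⟩, ⟨y, hy⟩] : Fin 2 → Fin τ.1) := by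
      intro a b hab
      fin_cases a <;> fin_cases b <;> simp_all
    refine h p21 rfl ⟨OrderEmbedding.ofStrictMono _ hmono, ?_⟩
    · intro (a : Fin 2) (b : Fin 2)
      change Equiv.swap 0 1 a < Equiv.swap 0 1 b ↔
        τ.2 (![⟨x, hx⟩, ⟨y, hy⟩] a) < τ.2 (![⟨x, hx⟩, ⟨y, hy⟩] b)
      fin_cases a <;> fin_cases b <;> simp_all [hgt.le]
  · rintro h _ rfl ⟨f, hf⟩
    have h1 : f (0 : Fin 2) < f (1 : Fin 2) := f.strictMono (by decide : (0 : Fin 2) < 1)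
    have h2 := h _ _ (Nat.zero_le _) h1 (f (1 : Fin 2)).2
    rw [value_fin, value_fin, Fin.val_fin_lt] at h2
    have h3 := (hf (1 : Fin 2) (0 : Fin 2)).1 (by decide)
    exact lt_asymm h2 h3

theorem nil_mem_av_p21 : nil ∈ Av {p21} :=
  mem_av_p21_iff.2 fun _ _ _ _ h => (Nat.not_lt_zero _ h).elim

theorem eq_nil_of_length {π : Permutation} (h : π.1 = 0) : π = nil :=
  positions_injective (by
    rw [List.eq_nil_of_length_eq_zero (l := positions π) (by simp [h])]
    rfl)

/-- The increasing permutation of length `n`. -/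
def increasing (n : ℕ) : Permutation := ⟨n, 1⟩

theorem value_increasing (n x : ℕ) : (increasing n).value x = x := by
  unfold value increasing
  split_ifs <;> rfl

theorem eq_increasing {π : Permutation} (h : π.IncreasingFrom 0) : π = increasing π.1 := by
  refine positions_injective ?_
  have h1 := (increasingFrom_iff (n := 0) (m := π.1) (by omega)).1 h
  have h2 := (increasingFrom_iff (π := increasing π.1) (n := 0) (m := π.1)
    (by simp [increasing])).1 fun x y _ hxy _ => by rwa [value_increasing, value_increasing]
  simp only [Nat.zero_le, decide_true, List.filter_true] at h1 h2
  rw [h1, h2]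

theorem increasing_mem_av (n : ℕ) : increasing n ∈ Av {p21} :=
  mem_av_p21_iff.2 fun x y _ hxy _ => by rwa [value_increasing, value_increasing]

/-- `π` consists of entries in the order of the nonempty permutation `σ`, followed by a nonempty
increasing sequence that cannot be extended to the left. -/
def IsExtension (σ π : Permutation) : Prop :=
  1 ≤ σ.1 ∧ σ.1 < π.1 ∧ IsPrefix σ π ∧ π.IncreasingFrom σ.1 ∧
    π.value σ.1 < π.value (σ.1 - 1)

theorem IsExtension.not_increasingFrom {σ π : Permutation} (h : IsExtension σ π) {n : ℕ}
    (hn : n < σ.1) : ¬ π.IncreasingFrom n := fun hinc =>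
  lt_asymm h.2.2.2.2 (hinc _ _ (by omega) (by have := h.1; omega) h.2.1)

theorem IsExtension.unique {σ σ' π : Permutation} (h : IsExtension σ π) (h' : IsExtension σ' π) :
    σ = σ' := by
  refine h.2.2.1.eq h'.2.2.1 (le_antisymm ?_ ?_) <;> by_contra hlt
  · exact h.not_increasingFrom (not_le.1 hlt) h'.2.2.2.1
  · exact h'.not_increasingFrom (not_le.1 hlt) h.2.2.2.1

theorem isJuxtaposition_increasing_iff {π σ τ : Permutation} :
    IsJuxtaposition π σ τ ∧ τ.IncreasingFrom 0 ↔
      σ.1 + τ.1 = π.1 ∧ IsPrefix σ π ∧ π.IncreasingFrom σ.1 ∧ τ.IncreasingFrom 0 := by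
  constructor
  · rintro ⟨⟨h, h1, h2⟩, hτ⟩
    refine ⟨h, ⟨by omega, fun x hx y hy => ?_⟩, fun x y hx hxy hy => ?_, hτ⟩
    · have := h1 ⟨x, hx⟩ ⟨y, hy⟩
      rw [value_of_lt σ hx, value_of_lt σ hy, value_of_lt π (by omega : x < π.1),
        value_of_lt π (by omega : y < π.1)]
      exact this
    · have hx' : x - σ.1 < τ.1 := by omega
      have hy' : y - σ.1 < τ.1 := by omega
      have h3 := hτ (x - σ.1) (y - σ.1) (Nat.zero_le _) (by omega) hy'
      rw [value_of_lt τ hx', value_of_lt τ hy'] at h3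
      have h4 := (h2 ⟨x - σ.1, hx'⟩ ⟨y - σ.1, hy'⟩).1 h3
      rw [value_of_lt π (hxy.trans hy), value_of_lt π hy]
      have e1 : (Fin.cast h (Fin.natAdd σ.1 ⟨x - σ.1, hx'⟩)) = ⟨x, hxy.trans hy⟩ :=
        Fin.ext (by simp; omega)
      have e2 : (Fin.cast h (Fin.natAdd σ.1 ⟨y - σ.1, hy'⟩)) = ⟨y, hy⟩ :=
        Fin.ext (by simp; omega)
      simp only [e1, e2] at h4
      exact h4
  · rintro ⟨h, h1, h2, hτ⟩
    refine ⟨⟨h, fun i j => ?_, fun i j => ?_⟩, hτ⟩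
    · have := h1.2 i i.2 j j.2
      rw [value_fin, value_fin, value_of_lt π (by omega : (i : ℕ) < π.1),
        value_of_lt π (by omega : (j : ℕ) < π.1)] at this
      exact this
    · have key : ∀ i j : Fin τ.1, i < j → τ.2 i < τ.2 j ∧
          π.2 (Fin.cast h (Fin.natAdd σ.1 i)) < π.2 (Fin.cast h (Fin.natAdd σ.1 j)) := by
        intro i j hij
        have h3 := hτ i j (Nat.zero_le _) hij j.2
        have h4 := h2 (σ.1 + i) (σ.1 + j) (by omega) (by simpa using hij) (by omega)
        rw [value_fin, value_fin] at h3
        rw [value_of_lt π (by omega : σ.1 + i < π.1),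
          value_of_lt π (by omega : σ.1 + j < π.1)] at h4
        exact ⟨h3, h4⟩
      rcases lt_trichotomy i j with hij | rfl | hij
      · exact ⟨fun _ => (key i j hij).2, fun _ => (key i j hij).1⟩
      · simp
      · exact ⟨fun h' => (lt_asymm h' (key j i hij).1).elim,
          fun h' => (lt_asymm h' (key j i hij).2).elim⟩

/-- The juxtapositions of a class with an increasing sequence: the empty permutation, the nonempty
increasing permutations, and the extensions of the nonempty members of the class. -/
theorem mem_juxtapose_increasing_iff {C : Set Permutation} (hC : IsPermClass (insert nil C))
    {π : Permutation} : π ∈ juxtapose C (Av {p21}) ↔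
      π = nil ∨ (∃ k, π = increasing (k + 1)) ∨ ∃ σ ∈ C, IsExtension σ π := by
  rw [juxtapose, Set.insert_eq_of_mem nil_mem_av_p21]
  constructor
  · rintro ⟨σ, hσ, τ, hτ, hj⟩
    obtain ⟨hlen, hpre, hinc, -⟩ :=
      isJuxtaposition_increasing_iff.1 ⟨hj, mem_av_p21_iff.1 hτ⟩
    classical
    have hex : ∃ n, π.IncreasingFrom n := ⟨_, hinc⟩
    have hn := Nat.find_spec hex
    have hmin := fun m (hm : m < Nat.find hex) => Nat.find_min hex hm
    have hle : Nat.find hex ≤ σ.1 := Nat.find_min' hex hinc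
    generalize Nat.find hex = n at hn hmin hle
    rcases Nat.eq_zero_or_pos π.1 with h0 | hpos
    · exact .inl (eq_nil_of_length h0)
    rcases Nat.eq_zero_or_pos n with rfl | hn0
    · refine .inr (.inl ⟨π.1 - 1, ?_⟩)
      rw [show π.1 - 1 + 1 = π.1 by omega]
      exact eq_increasing hn
    obtain ⟨ρ, hρn, hρ⟩ := exists_isPrefix π (hle.trans hpre.1)
    have hρC : ρ ∈ insert nil C := hC σ hσ ρ (hρ.contained hpre (by omega))
    have hρ' : ρ ∈ C := by
      rcases hρC with rfl | h
      · simp [nil] at hρn; omega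
      · exact h
    refine .inr (.inr ⟨ρ, hρ', by omega, ?_, hρ, hρn ▸ hn, ?_⟩) <;> by_contra hcon
    · exact hmin (n - 1) (by omega) fun x y _ _ _ => by omega
    · refine hmin (n - 1) (by omega) fun x y hx hxy hy => ?_
      have hlt : π.value (n - 1) < π.value n := by
        rw [hρn] at hcon
        refine lt_of_le_of_ne (not_lt.1 hcon) fun h => ?_
        have := π.value_injective h
        omega
      rcases Nat.lt_or_ge x n with h | h
      · obtain rfl : x = n - 1 := by omega
        rcases Nat.lt_or_ge n y with h' | h'
        · exact hlt.trans (hn n y le_rfl h' hy)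
        · obtain rfl : y = n := by omega
          exact hlt
      · exact hn x y h hxy hy
  · rintro (rfl | ⟨k, rfl⟩ | ⟨σ, hσ, hext⟩)
    · exact ⟨nil, .inl rfl, nil, nil_mem_av_p21, (isJuxtaposition_increasing_iff.2
        ⟨rfl, ⟨le_rfl, fun _ _ _ _ => Iff.rfl⟩, mem_av_p21_iff.1 nil_mem_av_p21,
          mem_av_p21_iff.1 nil_mem_av_p21⟩).1⟩
    · have h := mem_av_p21_iff.1 (increasing_mem_av (k + 1))
      exact ⟨nil, .inl rfl, increasing (k + 1), increasing_mem_av _,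
        (isJuxtaposition_increasing_iff.2 ⟨Nat.zero_add _,
          ⟨Nat.zero_le _, fun x hx => (Nat.not_lt_zero x hx).elim⟩, h, h⟩).1⟩
    · have := hext.2.1
      exact ⟨σ, .inr hσ, increasing (π.1 - σ.1), increasing_mem_av _,
        (isJuxtaposition_increasing_iff.2 ⟨by simp [increasing]; omega, hext.2.2.1,
          hext.2.2.2.1, mem_av_p21_iff.1 (increasing_mem_av _)⟩).1⟩

end Permutation

/-! ### Extensions of a permutation as shuffles -/

namespace Insertion

open Cls Permutation

/-- Replace the positions from `n` on by `none`. -/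
def unlabel (n : ℕ) (L : List ℕ) : List (Option ℕ) := L.map fun x => if x < n then some x else none

/-- Replace the occurrences of `none`, from left to right, by consecutive numbers that start with
`j`. -/
def relabel : ℕ → List (Option ℕ) → List ℕ
  | _, [] => []
  | j, none :: l => j :: relabel (j + 1) l
  | j, some x :: l => x :: relabel j l

theorem reduceOption_unlabel (n : ℕ) (L : List ℕ) :
    (unlabel n L).reduceOption = L.filter (· < n) := by
  induction L with
  | nil => rfl
  | cons x L ih =>
    by_cases h : x < n
    · simpa [unlabel, h] using ih
    · simpa [unlabel, h] using ih

theorem relabel_unlabel {n j m : ℕ} {L : List ℕ}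
    (h : L.filter (n ≤ ·) = List.range' j m) : relabel j (unlabel n L) = L := by
  induction L generalizing j m with
  | nil => rfl
  | cons x L ih =>
    by_cases hx : x < n
    · rw [List.filter_cons_of_neg (by simpa using hx)] at h
      have := ih h
      simp_all [unlabel, relabel]
    · rw [List.filter_cons_of_pos (by simpa using hx)] at h
      cases m with
      | zero => simp at h
      | succ m =>
        rw [List.range'_succ, List.cons.injEq] at h
        obtain ⟨rfl, h⟩ := h
        have := ih h
        rw [unlabel] at this
        rw [unlabel, List.map_cons, if_neg hx, relabel, this]

theorem unlabel_relabel {n j : ℕ} (hj : n ≤ j) {l : List (Option ℕ)}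
    (h : ∀ x ∈ l.reduceOption, x < n) : unlabel n (relabel j l) = l := by
  induction l generalizing j with
  | nil => rfl
  | cons o l ih =>
    cases o with
    | none =>
      have := ih (j := j + 1) (by omega) (by simpa using h)
      simp_all [unlabel, relabel]
    | some x =>
      simp only [List.reduceOption_cons_of_some, List.mem_cons, forall_eq_or_imp] at h
      have := ih hj h.2
      simp_all [unlabel, relabel]

theorem filter_ge_relabel {n j : ℕ} (hj : n ≤ j) {l : List (Option ℕ)}
    (h : ∀ x ∈ l.reduceOption, x < n) :
    (relabel j l).filter (n ≤ ·) = List.range' j (l.count none) := by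
  induction l generalizing j with
  | nil => rfl
  | cons o l ih =>
    cases o with
    | none =>
      rw [relabel, List.filter_cons_of_pos (by simpa using hj),
        ih (j := j + 1) (by omega) (by simpa using h), List.count_cons_self, List.range'_succ]
    | some x =>
      simp only [List.reduceOption_cons_of_some, List.mem_cons, forall_eq_or_imp] at h
      rw [relabel, List.filter_cons_of_neg (by simpa using h.1), ih hj h.2,
        List.count_cons_of_ne (by simp)]

theorem filter_lt_relabel {n j : ℕ} (hj : n ≤ j) {l : List (Option ℕ)}
    (h : ∀ x ∈ l.reduceOption, x < n) : (relabel j l).filter (· < n) = l.reduceOption := by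
  rw [← reduceOption_unlabel, unlabel_relabel hj h]

/-- The atom of the entry at a position of a permutation of length `n`. -/
def markOf (trackL : Bool) (n x : ℕ) : Atom :=
  Atom.ofMarks (trackL && decide (x = 0)) (decide (x + 1 = n))

theorem isRight_markOf (trackL : Bool) (n x : ℕ) :
    (markOf trackL n x).isRight = decide (x + 1 = n) := by
  unfold markOf
  generalize (trackL && decide (x = 0)) = a
  generalize decide (x + 1 = n) = b
  cases a <;> cases b <;> rfl

theorem ofWord_bottomToTop (trackL : Bool) (π : Permutation) :
    Trace.ofWord (bottomToTop trackL true π) =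
      Trace.ofWord (π.positions.map (markOf trackL π.1)) := by
  rw [bottomToTop_eq]
  simp only [Bool.true_and]
  rfl

/-- The new entries come after position `0`, and the last of them in the list has the largest
position, so their atoms are those of a shuffle. -/
theorem shuffleWord_unlabel (trackL : Bool) {n j m N : ℕ} (hn : 1 ≤ n) (hj : n ≤ j) (hN : n < N)
    (hjm : j + m = N) {L : List ℕ} (h : L.filter (n ≤ ·) = List.range' j m) :
    shuffleWord (markOf trackL n) (unlabel n L) = Trace.ofWord (L.map (markOf trackL N)) := by
  induction L generalizing j m with
  | nil => rfl
  | cons x L ih =>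
    by_cases hx : x < n
    · rw [List.filter_cons_of_neg (by simpa using hx)] at h
      have := ih hj hjm h
      have e : markOf trackL N x = (markOf trackL n x).dropRight := by
        unfold markOf
        rw [decide_eq_false (show ¬ x + 1 = N by omega)]
        generalize (trackL && decide (x = 0)) = a
        generalize decide (x + 1 = n) = b
        cases a <;> cases b <;> rfl
      simp only [unlabel, List.map_cons, hx, if_true, shuffleWord, Trace.ofWord_cons, e]
      rw [← this]
      rfl
    · rw [List.filter_cons_of_pos (by simpa using hx)] at h
      cases m with
      | zero => simp at h
      | succ m =>
        rw [List.range'_succ, List.cons.injEq] at h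
        obtain ⟨rfl, h⟩ := h
        have := ih (j := x + 1) (by omega) (by omega) h
        have e : (markOf trackL N x) =
            if ((unlabel n L).any Option.isNone : Prop) then .Z else .ZR := by
          have h0 : x ≠ 0 := by omega
          have hany : (unlabel n L).any Option.isNone ↔ m ≠ 0 := by
            rw [any_isNone_iff]
            have hlen := congrArg List.length h
            rw [List.length_range'] at hlen
            rw [← hlen, Ne, List.length_eq_zero_iff, List.filter_eq_nil_iff]
            simp [unlabel]
          simp only [hany, markOf, h0, decide_false, Bool.and_false]
          by_cases hm : m = 0
          · rw [decide_eq_true (show x + 1 = N by omega)]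
            simp [hm, Atom.ofMarks]
          · rw [decide_eq_false (show ¬ x + 1 = N by omega)]
            simp [hm, Atom.ofMarks]
        simp only [unlabel, List.map_cons, hx, if_false, shuffleWord, Trace.ofWord_cons, e]
        rw [← this]
        rfl

/-- The first position after `σ` is the first new entry in the list, and the last position of `σ`
carries the mark, so the order of these two decides. -/
theorem newFirst_unlabel_iff (trackL : Bool) {n m : ℕ} (hn : 1 ≤ n) {L : List ℕ} (hL : L.Nodup)
    (hmem : n - 1 ∈ L) (h : L.filter (n ≤ ·) = List.range' n (m + 1)) :
    NewFirst (markOf trackL n) (unlabel n L) ↔ List.Sublist [n, n - 1] L := by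
  induction L with
  | nil => simp at hmem
  | cons x L ih =>
    rw [List.nodup_cons] at hL
    by_cases hx : x < n
    · rw [List.filter_cons_of_neg (by simpa using hx)] at h
      have e : unlabel n (x :: L) = some x :: unlabel n L := by simp [unlabel, hx]
      rw [e, NewFirst, isRight_markOf, List.sublist_cons_iff]
      have hne : n ≠ x := by omega
      by_cases hx1 : x = n - 1
      · have h1 : x + 1 = n := by omega
        have h2 : ¬ List.Sublist [n, n - 1] L := fun h' =>
          hL.1 (hx1 ▸ h'.subset (by simp))
        simp [h1, h2, hne]
      · have h1 : x + 1 ≠ n := by omega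
        have hmem' : n - 1 ∈ L := by
          rcases List.mem_cons.1 hmem with h' | h'
          · exact (hx1 h'.symm).elim
          · exact h'
        simp [h1, hne, ih hL.2 hmem' h]
    · rw [List.filter_cons_of_pos (by simpa using hx), List.range'_succ, List.cons.injEq] at h
      have hmem' : n - 1 ∈ L := by
        rcases List.mem_cons.1 hmem with h' | h'
        · omega
        · exact h'
      have e : unlabel n (x :: L) = none :: unlabel n L := by simp [unlabel, hx]
      rw [e, NewFirst, reduceOption_unlabel, h.1]
      refine iff_of_true ?_ ((List.singleton_sublist.2 hmem').cons_cons _)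
      exact List.ne_nil_of_mem (List.mem_filter.2 ⟨hmem', by simp; omega⟩)

theorem none_mem_of_newFirst {β : Type} {mark : β → Atom} {l : List (Option β)}
    (h : NewFirst mark l) : none ∈ l := by
  induction l with
  | nil => exact h.elim
  | cons o l ih =>
    cases o with
    | none => simp
    | some x => exact List.mem_cons_of_mem _ (ih h.2)

theorem isExtension_iff (trackL : Bool) {σ π : Permutation} (hσ : 1 ≤ σ.1) (hlt : σ.1 < π.1) :
    IsExtension σ π ↔ π.positions.filter (σ.1 ≤ ·) = List.range' σ.1 (π.1 - σ.1) ∧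
      (unlabel σ.1 π.positions).reduceOption = σ.positions ∧
        NewFirst (markOf trackL σ.1) (unlabel σ.1 π.positions) := by
  rw [IsExtension, isPrefix_iff hlt.le, increasingFrom_iff (m := π.1 - σ.1) (by omega),
    reduceOption_unlabel, ← pair_sublist_iff hlt (by omega)]
  simp only [hσ, hlt, true_and]
  rw [and_left_comm]
  refine and_congr_right fun h => and_congr_right fun _ => ?_
  rw [newFirst_unlabel_iff trackL hσ π.nodup_positions (mem_positions.2 (by omega))
    (m := π.1 - σ.1 - 1) (by rw [h]; congr 1; omega)]

/-- The extensions of `σ`, weighted by their bottom-to-top readings. -/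
def extensionCls (trackL : Bool) (σ : Permutation) : Cls Trace :=
  mk fun π : {π // IsExtension σ π} => Trace.ofWord (bottomToTop trackL true π.1)

/-- Every shuffle of the positions of `σ` with new entries comes from a permutation. -/
theorem exists_unlabel_eq {σ : Permutation} {l : List (Option ℕ)}
    (h : l.reduceOption = σ.positions) (hnone : none ∈ l) :
    ∃ π : Permutation, σ.1 < π.1 ∧ unlabel σ.1 π.positions = l ∧
      π.positions.filter (σ.1 ≤ ·) = List.range' σ.1 (π.1 - σ.1) := by
  have hlt : ∀ x ∈ l.reduceOption, x < σ.1 := fun x hx => by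
    rw [h] at hx
    exact mem_positions.1 hx
  have hge := filter_ge_relabel le_rfl hlt
  have hltf := filter_lt_relabel le_rfl hlt
  have hcount : 0 < l.count none := List.count_pos_iff.2 hnone
  have hperm := List.filter_append_perm (fun x => decide (x < σ.1)) (relabel σ.1 l)
  have hnot : (fun x => !decide (x < σ.1)) = fun x => decide (σ.1 ≤ x) := by
    funext x
    rw [Bool.eq_iff_iff]
    simp
  rw [hnot, hge, hltf, h] at hperm
  have hlen : σ.1 + l.count none = (relabel σ.1 l).length := by
    rw [← hperm.length_eq, List.length_append, length_positions, List.length_range']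
  obtain ⟨π, hπ⟩ := exists_positions_eq (L := relabel σ.1 l)
    (hperm.nodup_iff.1 (List.nodup_append.2 ⟨σ.nodup_positions, List.nodup_range', by
      intro a ha b hb
      have := mem_positions.1 ha
      have := List.mem_range'_1.1 hb
      omega⟩))
    (fun x hx => by
      rcases List.mem_append.1 (hperm.mem_iff.2 hx) with hx | hx
      · have := mem_positions.1 hx
        omega
      · have := List.mem_range'_1.1 hx
        omega)
  have hπ1 : π.1 = σ.1 + l.count none := by rw [← length_positions, hπ, hlen]
  refine ⟨π, by omega, by rw [hπ, unlabel_relabel le_rfl hlt], ?_⟩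
  rw [hπ, hge, hπ1, Nat.add_sub_cancel_left]

theorem newFirst_eq_extensionCls (trackL : Bool) (σ : Permutation) :
    newFirst (markOf trackL σ.1) σ.positions = extensionCls trackL σ := by
  rcases Nat.eq_zero_or_pos σ.1 with h0 | hpos
  · rw [List.eq_nil_of_length_eq_zero (l := σ.positions) (by simp [h0]), newFirst_nil]
    refine (eq_zero_of_isEmpty _ ⟨fun π => ?_⟩).symm
    have := π.2.1
    omega
  have hiff := fun (π : Permutation) h => isExtension_iff trackL (π := π) hpos h
  refine (mk_congr_of_bijective (X := {π // IsExtension σ π}) (fun π => ⟨unlabel σ.1 π.1.positions,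
    ((hiff π.1 π.2.2.1).1 π.2).2⟩) ⟨?_, ?_⟩ ?_).symm
  · rintro ⟨π, h⟩ ⟨π', h'⟩ he
    have he' : unlabel σ.1 π.positions = unlabel σ.1 π'.positions := congrArg Subtype.val he
    refine Subtype.ext (positions_injective ?_)
    rw [← relabel_unlabel ((hiff π h.2.1).1 h).1, he',
      relabel_unlabel ((hiff π' h'.2.1).1 h').1]
  · rintro ⟨l, h1, h2⟩
    obtain ⟨π, hlt, rfl, hge⟩ := exists_unlabel_eq h1 (none_mem_of_newFirst h2)
    exact ⟨⟨π, (hiff π hlt).2 ⟨hge, h1, h2⟩⟩, rfl⟩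
  · rintro ⟨π, h⟩
    rw [ofWord_bottomToTop]
    exact shuffleWord_unlabel trackL hpos le_rfl h.2.1 (Nat.add_sub_cancel' h.2.1.le)
      ((hiff π h.2.1).1 h).1

theorem positions_increasing (n : ℕ) : (increasing n).positions = List.range n := by
  refine List.ext_getElem (by simp [increasing]) fun i h1 h2 => ?_
  simp [positions, increasing]
  rfl

theorem ofWord_replicate (a : Atom) (k : ℕ) :
    Trace.ofWord (List.replicate k a) = Trace.atom a ^ k := by
  induction k with
  | zero => rfl
  | succ k ih => rw [List.replicate_succ, Trace.ofWord_cons, ih, pow_succ']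

theorem monotoneCls_eq (trackL : Bool) : monotoneCls trackL (star (letter .Z)) =
    mk fun k : ℕ => Trace.ofWord (bottomToTop trackL true (increasing (k + 1))) := by
  have hmid : ∀ (s k N : ℕ), (trackL = true → 1 ≤ s) → s + k < N →
      (List.range' s k).map (markOf trackL N) = List.replicate k .Z := by
    intro s k N hs hN
    rw [List.eq_replicate_iff]
    refine ⟨by simp, fun a ha => ?_⟩
    obtain ⟨x, hx, rfl⟩ := List.mem_map.1 ha
    rw [List.mem_range'_1] at hx
    rw [markOf, decide_eq_false (by omega : ¬ x + 1 = N)]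
    cases trackL with
    | false => rfl
    | true =>
      have := hs rfl
      rw [decide_eq_false (by omega : ¬ x = 0)]
      rfl
  have hword : ∀ k, Trace.ofWord (bottomToTop trackL true (increasing (k + 1))) =
      Trace.ofWord ((List.range' 0 k ++ [k]).map (markOf trackL (k + 1))) := fun k => by
    rw [ofWord_bottomToTop, positions_increasing, List.range_succ, List.range_eq_range']; rfl
  simp only [hword, List.map_append, Trace.ofWord_append]
  simp only [monotoneCls, letter, star_single]
  cases trackL with
  | false =>
    rw [if_neg (by simp)]
    refine mk_congr (Equiv.prodPUnit ℕ) fun p => ?_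
    simp [hmid 0 p.1 (p.1 + 1) (by simp) (by omega), ofWord_replicate, markOf, Atom.ofMarks,
      Trace.ofWord_cons]
  | true =>
    rw [if_pos rfl]
    refine mk_congr_of_bijective (X := Unit ⊕ (Unit × (ℕ × Unit)))
      (Sum.elim (fun _ => 0) fun p => p.2.1 + 1) ⟨?_, ?_⟩ ?_
    · rintro (_ | ⟨_, k, _⟩) (_ | ⟨_, k', _⟩) h <;> simp_all
    · rintro (_ | k)
      · exact ⟨.inl (), rfl⟩
      · exact ⟨.inr ((), k, ()), rfl⟩
    · rintro (_ | ⟨_, k, _⟩)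
      · rfl
      · have h1 := hmid 1 k (k + 1 + 1) (fun _ => le_rfl) (by omega)
        simp [List.range'_succ, h1, ofWord_replicate, markOf, Atom.ofMarks, Trace.ofWord_cons,
          mul_assoc]

theorem sig_mul {I : Type} (f : I → Cls Trace) (x : Cls Trace) :
    sig f * x = sig fun i => f i * x := by
  obtain ⟨X, u, rfl⟩ := exists_mk_family f
  obtain ⟨Y, v, rfl⟩ := exists_mk x
  simp only [sig_mk, mk_mul]
  exact mk_congr ⟨fun p => ⟨p.1.1, p.1.2, p.2⟩, fun p => (⟨p.1, p.2.1⟩, p.2.2), fun _ => rfl,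
    fun _ => rfl⟩ fun _ => rfl

theorem permCls_juxtapose {C : Set Permutation} (hC : IsPermClass (insert nil C))
    (trackL : Bool) :
    Specification.permCls trackL true (juxtapose C (Av {p21})) =
      insertionCls trackL (star (letter .Z)) (Specification.permCls trackL true C) := by
  have hsig : lift (run (star (letter .Z))) (Specification.permCls trackL true C) 0 1 *
      (star (letter .Z) * letter .ZR) +
      lift (run (star (letter .Z))) (Specification.permCls trackL true C) 0 2 =
      sig fun σ : C => extensionCls trackL σ := by
    rw [Specification.permCls, lift_mk, lift_mk, sig_mul, ← sig_add]
    congr 1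
    funext σ
    rw [ofWord_bottomToTop, run_eq_newFirst, newFirst_eq_extensionCls]
  rw [insertionCls, hsig, monotoneCls_eq]
  unfold extensionCls
  rw [sig_mk, one_eq, single, mk_add, mk_add]
  have hmem := fun π => mem_juxtapose_increasing_iff hC (π := π)
  let f : Unit ⊕ (ℕ ⊕ Σ σ : C, {π // IsExtension (σ : Permutation) π}) →
      (juxtapose C (Av {p21}) : Set Permutation) :=
    Sum.elim (fun _ => ⟨nil, (hmem _).2 (.inl rfl)⟩)
      (Sum.elim (fun k => ⟨increasing (k + 1), (hmem _).2 (.inr (.inl ⟨k, rfl⟩))⟩)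
        fun p => ⟨p.2.1, (hmem _).2 (.inr (.inr ⟨p.1, p.1.2, p.2.2⟩))⟩)
  have hext : ∀ {σ : Permutation} {k : ℕ}, ¬ IsExtension σ (increasing k) := fun {σ k} h =>
    h.not_increasingFrom (n := 0) h.1 (mem_av_p21_iff.1 (increasing_mem_av k))
  refine (mk_congr_of_bijective f ⟨?_, ?_⟩ ?_).symm
  · rintro (_ | k | ⟨σ, π, h⟩) (_ | k' | ⟨σ', π', h'⟩) he
    · rfl
    · have := congrArg (fun π => π.1.1) he
      simp [f, nil, increasing] at this
    · obtain rfl : nil = π' := congrArg Subtype.val he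
      exact (Nat.not_lt_zero _ h'.2.1).elim
    · have := congrArg (fun π => π.1.1) he
      simp [f, nil, increasing] at this
    · have := congrArg (fun π => π.1.1) he
      simp only [f, increasing, Sum.elim_inl, Sum.elim_inr] at this
      obtain rfl : k = k' := by omega
      rfl
    · obtain rfl : increasing (k + 1) = π' := congrArg Subtype.val he
      exact (hext h').elim
    · obtain rfl : π = nil := congrArg Subtype.val he
      exact (Nat.not_lt_zero _ h.2.1).elim
    · obtain rfl : π = increasing (k' + 1) := congrArg Subtype.val he
      exact (hext h).elim
    · obtain rfl : π = π' := congrArg Subtype.val he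
      obtain rfl : σ = σ' := Subtype.ext (h.unique h')
      rfl
  · rintro ⟨π, hπ⟩
    rcases (hmem π).1 hπ with rfl | ⟨k, rfl⟩ | ⟨σ, hσ, h⟩
    · exact ⟨.inl (), rfl⟩
    · exact ⟨.inr (.inl k), rfl⟩
    · exact ⟨.inr (.inr ⟨⟨σ, hσ⟩, π, h⟩), rfl⟩
  · rintro (_ | k | ⟨σ, π, h⟩) <;> rfl

end Insertion

/-! ### Symmetries -/

namespace Permutation

/-- The complement of a permutation: turn it upside down. -/
def complement (π : Permutation) : Permutation := ⟨π.1, π.2.trans Fin.revPerm⟩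

/-- The reverse of a permutation: read it from right to left. -/
def reversal (π : Permutation) : Permutation := ⟨π.1, Fin.revPerm.trans π.2⟩

theorem complement_involutive : Function.Involutive complement := fun π =>
  congrArg (Sigma.mk π.1) (Equiv.ext fun i => Fin.rev_rev (π.2 i))

theorem reversal_involutive : Function.Involutive reversal := fun π =>
  congrArg (Sigma.mk π.1) (Equiv.ext fun i => congrArg π.2 (Fin.rev_rev i))

theorem OrderIsoAt.complement {σ π : Permutation} {f : Fin σ.1 → Fin π.1}
    (h : OrderIsoAt σ π f) : OrderIsoAt σ.complement π.complement f := fun i j =>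
  Fin.rev_lt_rev.trans ((h j i).trans Fin.rev_lt_rev.symm)

theorem OrderIsoAt.reversal {σ π : Permutation} {f : Fin σ.1 → Fin π.1}
    (h : OrderIsoAt σ π f) :
    OrderIsoAt σ.reversal π.reversal fun i => Fin.rev (f (Fin.rev i)) := fun i j => by
  change _ ↔ π.2 (Fin.rev (Fin.rev _)) < π.2 (Fin.rev (Fin.rev _))
  rw [Fin.rev_rev, Fin.rev_rev]
  exact h (Fin.rev i) (Fin.rev j)

theorem Contained.complement {σ π : Permutation} (h : Contained σ π) :
    Contained σ.complement π.complement := by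
  obtain ⟨f, hf⟩ := h
  exact ⟨f, hf.complement⟩

theorem Contained.reversal {σ π : Permutation} (h : Contained σ π) :
    Contained σ.reversal π.reversal := by
  obtain ⟨f, hf⟩ := h
  exact ⟨OrderEmbedding.ofStrictMono (fun i => Fin.rev (f (Fin.rev i))) fun i j hij =>
    Fin.rev_lt_rev.2 (f.strictMono (Fin.rev_lt_rev.2 hij)), hf.reversal⟩

theorem complement_nil : complement nil = nil := eq_nil_of_length rfl

theorem reversal_nil : reversal nil = nil := eq_nil_of_length rfl

theorem complement_p12 : complement p12 = p21 := by
  refine Sigma.ext rfl (heq_of_eq (Equiv.ext fun (i : Fin 2) => ?_))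
  fin_cases i <;> rfl

theorem reversal_p12 : reversal p12 = p21 := by
  refine Sigma.ext rfl (heq_of_eq (Equiv.ext fun (i : Fin 2) => ?_))
  fin_cases i <;> rfl

section Involution

variable {Φ : Permutation → Permutation} (hΦ : Function.Involutive Φ)
  (hcont : ∀ {σ π}, Contained σ π → Contained (Φ σ) (Φ π)) (hnil : Φ nil = nil)

include hΦ in
theorem preimage_preimage_of_involutive (C : Set Permutation) : Φ ⁻¹' (Φ ⁻¹' C) = C :=
  Set.ext fun π => by simp [hΦ π]

include hΦ hnil in
theorem mem_insert_nil_preimage_iff {C : Set Permutation} {σ : Permutation} :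
    σ ∈ insert nil (Φ ⁻¹' C) ↔ Φ σ ∈ insert nil C := by
  have h : σ = nil ↔ Φ σ = nil :=
    ⟨fun h => h ▸ hnil, fun h => by rw [← hΦ σ, h, hnil]⟩
  simp [h]

include hΦ hcont hnil in
theorem isPermClass_preimage {C : Set Permutation} (hC : IsPermClass (insert nil C)) :
    IsPermClass (insert nil (Φ ⁻¹' C)) := by
  intro π hπ σ hσ
  rw [mem_insert_nil_preimage_iff hΦ hnil] at hπ ⊢
  exact hC _ hπ _ (hcont hσ)

include hΦ hcont in
theorem preimage_av (β : Permutation) : Φ ⁻¹' Av {β} = Av {Φ β} := by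
  ext π
  simp only [Av, Set.mem_preimage, Set.mem_singleton_iff, forall_eq, Set.mem_ofPred_eq]
  refine not_congr ⟨fun h => ?_, fun h => ?_⟩
  · simpa [hΦ π] using hcont h
  · simpa [hΦ β] using hcont h

end Involution

theorem IsJuxtaposition.complement {π σ τ : Permutation} (h : IsJuxtaposition π σ τ) :
    IsJuxtaposition π.complement σ.complement τ.complement := by
  obtain ⟨h, h1, h2⟩ := h
  exact ⟨h, h1.complement, h2.complement⟩

theorem IsJuxtaposition.reversal {π σ τ : Permutation} (h : IsJuxtaposition π σ τ) :
    IsJuxtaposition π.reversal τ.reversal σ.reversal := by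
  obtain ⟨h, h1, h2⟩ := h
  refine ⟨(add_comm _ _).trans h, ?_, ?_⟩
  · convert h2.reversal using 1
    funext (i : Fin τ.1)
    have := i.2
    apply Fin.ext
    change (i : ℕ) = π.1 - (σ.1 + (τ.1 - (i + 1)) + 1)
    omega
  · convert h1.reversal using 1
    funext (i : Fin σ.1)
    have := i.2
    apply Fin.ext
    change τ.1 + (i : ℕ) = π.1 - (σ.1 - (i + 1) + 1)
    omega

theorem preimage_complement_juxtapose (C D : Set Permutation) :
    complement ⁻¹' juxtapose C D = juxtapose (complement ⁻¹' C) (complement ⁻¹' D) := by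
  have h := fun {C : Set Permutation} {σ} =>
    mem_insert_nil_preimage_iff complement_involutive complement_nil (C := C) (σ := σ)
  ext π
  constructor
  · rintro ⟨σ, hσ, τ, hτ, hj⟩
    refine ⟨σ.complement, h.2 ?_, τ.complement, h.2 ?_, ?_⟩
    · rwa [complement_involutive]
    · rwa [complement_involutive]
    · simpa only [complement_involutive π] using hj.complement
  · rintro ⟨σ, hσ, τ, hτ, hj⟩
    exact ⟨_, h.1 hσ, _, h.1 hτ, hj.complement⟩

theorem preimage_reversal_juxtapose (C D : Set Permutation) :
    reversal ⁻¹' juxtapose C D = juxtapose (reversal ⁻¹' D) (reversal ⁻¹' C) := by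
  have h := fun {C : Set Permutation} {σ} =>
    mem_insert_nil_preimage_iff reversal_involutive reversal_nil (C := C) (σ := σ)
  ext π
  constructor
  · rintro ⟨σ, hσ, τ, hτ, hj⟩
    refine ⟨τ.reversal, h.2 ?_, σ.reversal, h.2 ?_, ?_⟩
    · rwa [reversal_involutive]
    · rwa [reversal_involutive]
    · simpa only [reversal_involutive π] using hj.reversal
  · rintro ⟨σ, hσ, τ, hτ, hj⟩
    exact ⟨_, h.1 hτ, _, h.1 hσ, hj.reversal⟩

theorem bottomToTop_complement (trackL trackR : Bool) (π : Permutation) :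
    bottomToTop trackL trackR π.complement = (bottomToTop trackL trackR π).reverse := by
  refine List.ext_getElem (by simp [bottomToTop, complement]) fun i h1 h2 => ?_
  simp only [bottomToTop, List.getElem_reverse, List.getElem_ofFn, List.length_ofFn]
  have hi : i < π.1 := by simpa [bottomToTop] using h2
  have e : (⟨π.1 - 1 - i, by omega⟩ : Fin π.1) = Fin.rev ⟨i, hi⟩ :=
    Fin.ext (by simp only [Fin.val_rev]; omega)
  rw [e]
  rfl

end Permutation

/-- Exchange the marks for the leftmost and the rightmost entry. -/
def Atom.swapMarks : Atom → Atom
  | Z => Z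
  | ZL => ZR
  | ZR => ZL
  | ZLR => ZLR

theorem Atom.swapMarks_ofMarks (a b : Bool) :
    (Atom.ofMarks a b).swapMarks = Atom.ofMarks b a := by
  cases a <;> cases b <;> rfl

theorem Permutation.bottomToTop_reversal (trackL trackR : Bool) (π : Permutation) :
    bottomToTop trackL trackR π.reversal =
      (bottomToTop trackR trackL π).map Atom.swapMarks := by
  rw [bottomToTop, bottomToTop, List.map_ofFn]
  refine congrArg List.ofFn (funext fun (v : Fin π.1) => ?_)
  change Atom.ofMarks (trackL && decide ((Fin.rev (π.2.symm v) : ℕ) = 0))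
    (trackR && decide ((Fin.rev (π.2.symm v) : ℕ) + 1 = π.1)) = (Atom.ofMarks _ _).swapMarks
  have hv := (π.2.symm v).2
  rw [Atom.swapMarks_ofMarks, Fin.val_rev]
  congr 2 <;> rw [decide_eq_decide] <;> omega

namespace Specification

open Cls Permutation

theorem permCls_preimage {Φ : Permutation → Permutation} (hΦ : Function.Involutive Φ)
    (trackL trackR : Bool) (C : Set Permutation) :
    permCls trackL trackR (Φ ⁻¹' C) =
      Cls.mk fun π : C => Trace.ofWord (bottomToTop trackL trackR (Φ π)) :=
  mk_congr ⟨fun π => ⟨Φ π, π.2⟩, fun π => ⟨Φ π, by simp [hΦ π.1]⟩,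
    fun π => Subtype.ext (hΦ π), fun π => Subtype.ext (hΦ π)⟩ fun π => by simp [hΦ π.1]

theorem IsBottomToTopFor.complement {S : Specification} {trackL trackR : Bool}
    {C : Set Permutation} (h : S.IsBottomToTopFor trackL trackR C) :
    S.reverse.IsBottomToTopFor trackL trackR (Permutation.complement ⁻¹' C) := by
  obtain ⟨hS, e, he⟩ := h
  obtain ⟨h1, h2⟩ := reverse_correct hS
  refine isBottomToTopFor_iff.2 ⟨h1, ?_⟩
  rw [h2, permCls_preimage complement_involutive]
  exact mk_congr e fun d => by rw [bottomToTop_complement, he]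

theorem IsBottomToTopFor.reversal {S : Specification} {trackL trackR : Bool}
    {C : Set Permutation} (h : S.IsBottomToTopFor trackL trackR C) :
    (S.relabel Atom.swapMarks).IsBottomToTopFor trackR trackL (Permutation.reversal ⁻¹' C) := by
  obtain ⟨hS, e, he⟩ := h
  obtain ⟨h1, h2⟩ := relabel_correct hS Atom.swapMarks
  refine isBottomToTopFor_iff.2 ⟨h1, ?_⟩
  rw [h2, permCls_preimage reversal_involutive]
  exact mk_congr e fun d => by rw [bottomToTop_reversal, he]

/-- A monotone class can be placed on the right of a class whose rightmost entry is tracked. -/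
theorem exists_juxtapose_right {C : Set Permutation} (hC : IsPermClass (insert nil C))
    {M : Set Permutation} (hM : M = Av {p21} ∨ M = Av {p12}) {K : Kind} {S : Specification}
    (hS : S.HasKind K) {trackL : Bool} (h : S.IsBottomToTopFor trackL true C) :
    ∃ S' : Specification, S'.HasKind K ∧ S'.IsBottomToTopFor trackL true (juxtapose C M) := by
  have key : ∀ {C : Set Permutation}, IsPermClass (insert nil C) → ∀ {S : Specification},
      S.HasKind K → S.IsBottomToTopFor trackL true C → ∃ S' : Specification, S'.HasKind K ∧
        S'.IsBottomToTopFor trackL true (juxtapose C (Av {p21})) := by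
    intro C hC S hS h
    rw [isBottomToTopFor_iff] at h
    obtain ⟨S', h1, h2, h3⟩ := Insertion.exists_specification h.1 hS trackL
    exact ⟨S', h1, isBottomToTopFor_iff.2
      ⟨h2, by rw [h3, h.2, Insertion.permCls_juxtapose hC]⟩⟩
  rcases hM with rfl | rfl
  · exact key hC hS h
  · obtain ⟨S', h1, h2⟩ := key
      (isPermClass_preimage complement_involutive Contained.complement complement_nil hC)
      (hasKind_reverse hS) h.complement
    refine ⟨S'.reverse, hasKind_reverse h1, ?_⟩
    have := h2.complement
    rwa [preimage_complement_juxtapose, preimage_preimage_of_involutive complement_involutive,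
      preimage_av complement_involutive Contained.complement, ← complement_p12,
      complement_involutive] at this

/-- A monotone class can be placed on the left of a class whose leftmost entry is tracked. -/
theorem exists_juxtapose_left {C : Set Permutation} (hC : IsPermClass (insert nil C))
    {M : Set Permutation} (hM : M = Av {p21} ∨ M = Av {p12}) {K : Kind} {S : Specification}
    (hS : S.HasKind K) {trackR : Bool} (h : S.IsBottomToTopFor true trackR C) :
    ∃ S' : Specification, S'.HasKind K ∧ S'.IsBottomToTopFor true trackR (juxtapose M C) := by
  have hav := preimage_av reversal_involutive Contained.reversal
  have hM' : Permutation.reversal ⁻¹' M = Av {p21} ∨ Permutation.reversal ⁻¹' M = Av {p12} := by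
    rcases hM with rfl | rfl
    · right; rw [hav, ← reversal_p12, reversal_involutive]
    · left; rw [hav, reversal_p12]
  obtain ⟨S', h1, h2⟩ := exists_juxtapose_right
    (isPermClass_preimage reversal_involutive Contained.reversal reversal_nil hC) hM'
    (hasKind_relabel hS _) h.reversal
  refine ⟨S'.relabel Atom.swapMarks, hasKind_relabel h1 _, ?_⟩
  have := h2.reversal
  rwa [preimage_reversal_juxtapose, preimage_preimage_of_involutive reversal_involutive,
    preimage_preimage_of_involutive reversal_involutive] at this

end Specification

theorem theorem1
    (C : Set Permutation) (hC : Permutation.IsPermClass (insert Permutation.nil C))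
    (M : Set Permutation)
    (hM : M = Permutation.Av {Permutation.p21} ∨ M = Permutation.Av {Permutation.p12})
    (K : Specification.Kind) (S : Specification) (hS : S.HasKind K) :
    (S.TracksRight C →
      ∃ S' : Specification, S'.HasKind K ∧ S'.TracksRight (Permutation.juxtapose C M)) ∧
    (S.TracksLeft C →
      ∃ S' : Specification, S'.HasKind K ∧ S'.TracksLeft (Permutation.juxtapose M C)) ∧
    (S.TracksBoth C →
      (∃ S' : Specification, S'.HasKind K ∧ S'.TracksBoth (Permutation.juxtapose C M)) ∧
      (∃ S' : Specification, S'.HasKind K ∧ S'.TracksBoth (Permutation.juxtapose M C))) :=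
  ⟨fun h => Specification.exists_juxtapose_right hC hM hS h,
    fun h => Specification.exists_juxtapose_left hC hM hS h,
    fun h => ⟨Specification.exists_juxtapose_right hC hM hS h,
      Specification.exists_juxtapose_left hC hM hS h⟩⟩
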